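/- Let $\beta>1$ and $b_\beta=\lfloor 100\beta^{100}\rfloor$. Let $\Theta$ be a Schwartz function on $\mathbb R$ supported in $(-1,1)$ with $\Theta(\xi)=1$ for $|\xi|\le 1/2$, and let $\Phi$ be the Schwartz function with $\widehat\Phi(\xi)=\Theta(\xi/2)-\Theta(\xi)$. Let $J$ be one of the intervals $[1/16,9/16]$, $[-9/16,-1/16]$. For $m\in\mathbb Z$ and $\xi,\eta\in\mathbb R$ put $$\phi_{4,\xi,\eta}(t)=2^{m+1}\xi t+2^{-b_\beta+2}\eta t^2-|t|^{-\beta}\qquad(t\neq 0),$$ and let $D_m$ be the set of those $(\xi,\eta)$ for which $\phi_{4,\xi,\eta}$ has a critical point $t_0(\xi,\eta)$ in $J$ (for $|\eta|\le1$ there is at most one). On $D_m$ put $Q(\xi,\eta)=\phi_{4,\xi,\eta}(t_0(\xi,\eta))$. For integers $-b_\beta<m<b_\beta$ and $j\ge 0$ let $$\tilde\Lambda_{j,\beta,m,4}(f_1,f_2,f_3)=\iint_{D_m} f_1(\xi)\,f_2(\eta)\,f_3\big(2^{b_\beta+m-1-j}\xi+\eta\big)\,\widehat\Phi(\xi)\,\Theta(\eta)\,e^{i2^{\beta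 j}Q(\xi,\eta)}\,d\xi\,d\eta .$$ Then there is a constant $C_\beta$, depending only on $\beta$ and on the fixed function $\Theta$ (in particular not on $j$, $m$), such that for all integers $-b_\beta<m<b_\beta$ and $j\ge0$, all $f_1\in L^4(\mathbb R)$ and all $f_2,f_3\in L^2(\mathbb R)$ the integral converges absolutely and $$\big|\tilde\Lambda_{j,\beta,m,4}(f_1,f_2,f_3)\big|\le C_\beta\,2^{-\varepsilon_0 j}\,\|f_1\|_4\,\|f_2\|_2\,\|f_3\|_2,\qquad \varepsilon_0=\frac{\beta-1}{5}.$$ -/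

import Mathlib

open MeasureTheory
open scoped SchwartzMap

noncomputable section

/-- The integer `b_β = [100 β^100]` (integer part). -/
def bBeta (β : ℝ) : ℤ := ⌊100 * β ^ 100⌋

/-- The phase `φ_{4,ξ,η}(t) = 2^{m+1} ξ t + 2^{-b_β+2} η t² - |t|^{-β}`. -/
def phase4 (β : ℝ) (m : ℤ) (ξ η t : ℝ) : ℝ :=
  (2 : ℝ) ^ (m + 1) * ξ * t + (2 : ℝ) ^ (-bBeta β + 2) * η * t ^ 2 - |t| ^ (-β)

/-- `t` is a critical point, lying in `J`, of the phase `φ_{4,ξ,η}`. The set `J` will always be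
a compact interval that avoids `0`, so that the phase is smooth on `J`. -/
def IsCritPoint (β : ℝ) (m : ℤ) (J : Set ℝ) (ξ η t : ℝ) : Prop :=
  t ∈ J ∧ deriv (phase4 β m ξ η) t = 0

/-- The set of the frequencies `(ξ, η)` at which the phase has a critical point in `J`. -/
def critSet (β : ℝ) (m : ℤ) (J : Set ℝ) : Set (ℝ × ℝ) :=
  {p | ∃ t, IsCritPoint β m J p.1 p.2 t}

open Classical in
/-- The critical point `t₀(ξ, η) ∈ J` of the phase (only used on `critSet`, where it exists;
for `|η| ≤ 1` it is unique by `IsCritPoint.unique` below). -/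
def critPoint (β : ℝ) (m : ℤ) (J : Set ℝ) (ξ η : ℝ) : ℝ :=
  if h : ∃ t, IsCritPoint β m J ξ η t then h.choose else 0

/-- `Q(ξ, η) = φ_{4,ξ,η}(t₀(ξ, η))`. -/
def phaseQ (β : ℝ) (m : ℤ) (J : Set ℝ) (ξ η : ℝ) : ℝ :=
  phase4 β m ξ η (critPoint β m J ξ η)

/-- The function `ξ ↦ Θ(ξ/2) - Θ(ξ)`, which is the Fourier transform of `Φ`. -/
def hatPhi (Θ : 𝓢(ℝ, ℂ)) (ξ : ℝ) : ℂ := Θ (ξ / 2) - Θ ξ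

/-- The integrand
`f₁(ξ) f₂(η) f₃(2^{b_β+m-1-j} ξ + η) Φ̂(ξ) Θ(η) e^{i 2^{βj} Q(ξ,η)}`
of the trilinear form, on the set of those `(ξ, η)` for which `t₀(ξ, η)` exists. -/
def oscIntegrand (Θ : 𝓢(ℝ, ℂ)) (β : ℝ) (m : ℤ) (j : ℕ) (J : Set ℝ) (f₁ f₂ f₃ : ℝ → ℂ) :
    ℝ × ℝ → ℂ :=
  (critSet β m J).indicator fun p =>
    f₁ p.1 * f₂ p.2 * f₃ ((2 : ℝ) ^ (bBeta β + m - 1 - (j : ℤ)) * p.1 + p.2)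
      * hatPhi Θ p.1 * Θ p.2
      * Complex.exp (Complex.I * (((2 : ℝ) ^ (β * j) * phaseQ β m J p.1 p.2 : ℝ) : ℂ))

/-- The trilinear oscillatory form. -/
def oscForm (Θ : 𝓢(ℝ, ℂ)) (β : ℝ) (m : ℤ) (j : ℕ) (J : Set ℝ) (f₁ f₂ f₃ : ℝ → ℂ) : ℂ :=
  ∫ p : ℝ × ℝ, oscIntegrand Θ β m j J f₁ f₂ f₃ p

theorem deriv_phase4_of_pos (β : ℝ) (m : ℤ) (ξ η t : ℝ) (ht : 0 < t) :
    deriv (phase4 β m ξ η) t =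
      (2 : ℝ) ^ (m + 1) * ξ + (2 : ℝ) ^ (-bBeta β + 2) * η * (2 * t) + β * t ^ (-β - 1) := by
  have h1 : HasDerivAt (fun s : ℝ => |s| ^ (-β)) (-β * t ^ (-β - 1)) t := by
    refine (Real.hasDerivAt_rpow_const (p := -β) (Or.inl ht.ne')).congr_of_eventuallyEq ?_
    filter_upwards [lt_mem_nhds ht] with s hs
    rw [abs_of_pos hs]
  have h2 := (((hasDerivAt_id t).const_mul ((2 : ℝ) ^ (m + 1) * ξ)).add
    (((hasDerivAt_id t).pow 2).const_mul ((2 : ℝ) ^ (-bBeta β + 2) * η))).sub h1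
  have h3 : HasDerivAt (phase4 β m ξ η) _ t := h2
  rw [h3.deriv]
  simp

theorem phase4_neg (β : ℝ) (m : ℤ) (ξ η t : ℝ) :
    phase4 β m ξ η (-t) = phase4 β m (-ξ) η t := by
  simp [phase4]

theorem IsCritPoint.neg {β : ℝ} {m : ℤ} {ξ η t : ℝ}
    (h : IsCritPoint β m (Set.Icc (-9 / 16) (-1 / 16)) ξ η t) :
    IsCritPoint β m (Set.Icc (1 / 16) (9 / 16)) (-ξ) η (-t) := by
  obtain ⟨⟨h1, h2⟩, h3⟩ := h
  refine ⟨⟨by linarith, by linarith⟩, ?_⟩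
  have e : phase4 β m (-ξ) η = fun s => phase4 β m ξ η (-s) := by
    funext s
    rw [phase4_neg]
  rw [e, deriv_comp_neg, neg_neg, h3, neg_zero]

theorem critPoint_aux {β : ℝ} (hβ : 1 < β) {m : ℤ} {ξ η : ℝ} (hη : |η| ≤ 1) {s t : ℝ}
    (hs : IsCritPoint β m (Set.Icc (1 / 16) (9 / 16)) ξ η s)
    (ht : IsCritPoint β m (Set.Icc (1 / 16) (9 / 16)) ξ η t) : ¬ s < t := by
  intro hst
  obtain ⟨⟨s1, s2⟩, s3⟩ := hs
  obtain ⟨⟨t1, t2⟩, t3⟩ := ht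
  have s0 : 0 < s := by linarith
  have t0 : 0 < t := by linarith
  rw [deriv_phase4_of_pos _ _ _ _ _ s0] at s3
  rw [deriv_phase4_of_pos _ _ _ _ _ t0] at t3
  have hb : (100 : ℤ) ≤ bBeta β := by
    refine Int.le_floor.2 ?_
    have := one_le_pow₀ hβ.le (n := 100)
    push_cast
    linarith
  have hB : (2 : ℝ) ^ (-bBeta β + 2) ≤ 1 / 2 := by
    calc (2 : ℝ) ^ (-bBeta β + 2) ≤ (2 : ℝ) ^ (-1 : ℤ) :=
          zpow_le_zpow_right₀ (by norm_num) (by omega)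
      _ = 1 / 2 := by norm_num
  have hB0 : (0 : ℝ) < (2 : ℝ) ^ (-bBeta β + 2) := by positivity
  have hBη : (2 : ℝ) ^ (-bBeta β + 2) * η ≤ 1 / 2 := by
    nlinarith [(abs_le.1 hη).2]
  have key : ∀ r : ℝ, 0 < r → r ^ (-β - 1) = r ^ (-β) * r⁻¹ := by
    intro r hr
    rw [Real.rpow_sub hr, Real.rpow_one, div_eq_mul_inv]
  rw [key s s0] at s3
  rw [key t t0] at t3
  have k1 : 1 ≤ t ^ (-β) :=
    Real.one_le_rpow_of_pos_of_le_one_of_nonpos t0 (by linarith) (by linarith)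
  have k2 : t ^ (-β) ≤ s ^ (-β) :=
    Real.rpow_le_rpow_of_nonpos s0 hst.le (by linarith)
  have k3 : t - s < s⁻¹ - t⁻¹ := by
    rw [inv_sub_inv s0.ne' t0.ne', lt_div_iff₀ (mul_pos s0 t0)]
    have : s * t < 1 := by nlinarith
    nlinarith
  have k4 : s⁻¹ - t⁻¹ ≤ s ^ (-β) * s⁻¹ - t ^ (-β) * t⁻¹ := by
    have := inv_pos.2 s0
    nlinarith
  nlinarith

/-- The critical point is unique whenever `η` lies in the support of `Θ`. -/
theorem IsCritPoint.unique {β : ℝ} (hβ : 1 < β) {m : ℤ} {J : Set ℝ}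
    (hJ : J = Set.Icc (1 / 16) (9 / 16) ∨ J = Set.Icc (-9 / 16) (-1 / 16))
    {ξ η : ℝ} (hη : |η| ≤ 1) {s t : ℝ}
    (hs : IsCritPoint β m J ξ η s) (ht : IsCritPoint β m J ξ η t) : s = t := by
  rcases hJ with rfl | rfl
  · exact le_antisymm (not_lt.1 (critPoint_aux hβ hη ht hs)) (not_lt.1 (critPoint_aux hβ hη hs ht))
  · have hs' := hs.neg
    have ht' := ht.neg
    have := le_antisymm (not_lt.1 (critPoint_aux hβ hη ht' hs'))
      (not_lt.1 (critPoint_aux hβ hη hs' ht'))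
    linarith

end

/-! Write A = 2^(m+1), B = 2^(2-b_β), λ = 2^(βj) and ε = 2^(b_β+m-1-j) = (A/B)·2^(-j). The proof is
a double Cauchy–Schwarz (TT*) argument followed by a one-dimensional van der Corput estimate.

Cauchy–Schwarz in u = εξ + η removes f₃ and doubles the ξ variable to x, x + τ. This pairs f₁ into
F_τ(x) = f₁(x) conj f₁(x+τ), whose L² norm is at most ‖f₁‖₄² for every τ, and f₂ into G_τ(y) = f₂(y)
conj f₂(y-ετ), with ∫‖G_τ‖₂² dτ = |ε|⁻¹‖f₂‖₂⁴. For fixed τ a second Cauchy–Schwarz removes F_τ and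
leaves correlations in x of the kernel at heights y and y' (`norm_bilinear_sq_le`,
`norm_trilinear_pow_four_le`). Such a correlation is an oscillatory integral whose phase is λ times
the double difference of Q over a parallelogram with sides τ(1,-ε) and (0,y'-y).

Since ∂Q/∂ξ = A t₀, the derivative of that phase is governed by ∂_η(∂_ξ - ε∂_η)t₀. Implicit
differentiation computes this quantity explicitly; it is bounded below by a positive constant once
|ε|B ≤ A/4, that is, j ≥ 2 (`le_abs_doubleDiff_crit`). Van der Corput then bounds the correlation by
a constant times min(1, (λ|τ||y-y'|)⁻¹), hence by (λ|τ||y-y'|)^(-θ) for every θ in [0,1]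
(`norm_correlation_oscKernel_le`). For θ < 1 both singularities are integrable: Schur's test absorbs
|y-y'|^(-θ) and Cauchy–Schwarz in τ absorbs |τ|^(-θ).

The fourth power of the form thus gains λ^(-θ) and loses |ε|⁻¹, which is of size 2^j. The choice θ =
(4β+1)/(5β) < 1 makes the balance exactly 2^(-4ε₀j). The cases j ≤ 1 need no oscillation, the
negative interval J reduces to the positive one by reflecting ξ, and the finitely many values of m
are handled by summing constants. -/

open scoped ComplexConjugate

/-! ### Cauchy–Schwarz inequalities. -/

section CauchySchwarz

variable {X U : Type*} [MeasurableSpace X] [MeasurableSpace U]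

/-- The Cauchy–Schwarz inequality for real integrals. -/
theorem sq_integral_mul_le {μ : Measure X} {f g : X → ℝ}
    (hf : AEStronglyMeasurable f μ) (hg : AEStronglyMeasurable g μ)
    (hf2 : Integrable (fun x => f x ^ 2) μ) (hg2 : Integrable (fun x => g x ^ 2) μ)
    (hf0 : ∀ x, 0 ≤ f x) (hg0 : ∀ x, 0 ≤ g x) :
    (∫ x, f x * g x ∂μ) ^ 2 ≤ (∫ x, f x ^ 2 ∂μ) * ∫ x, g x ^ 2 ∂μ := by
  have hfm : MemLp f (ENNReal.ofReal 2) μ := by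
    simpa using (memLp_two_iff_integrable_sq hf).2 hf2
  have hgm : MemLp g (ENNReal.ofReal 2) μ := by
    simpa using (memLp_two_iff_integrable_sq hg).2 hg2
  have h := integral_mul_le_Lp_mul_Lq_of_nonneg (μ := μ) Real.HolderConjugate.two_two
    (Filter.Eventually.of_forall hf0) (Filter.Eventually.of_forall hg0) hfm hgm
  simp only [Real.rpow_two, ← Real.sqrt_eq_rpow] at h
  have h0 : 0 ≤ ∫ x, f x * g x ∂μ := integral_nonneg fun x => mul_nonneg (hf0 x) (hg0 x)
  have h1 : 0 ≤ ∫ x, f x ^ 2 ∂μ := integral_nonneg fun x => sq_nonneg _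
  have h2 : 0 ≤ ∫ x, g x ^ 2 ∂μ := integral_nonneg fun x => sq_nonneg _
  calc _ ≤ (√(∫ x, f x ^ 2 ∂μ) * √(∫ x, g x ^ 2 ∂μ)) ^ 2 := by gcongr
    _ = _ := by rw [mul_pow, Real.sq_sqrt h1, Real.sq_sqrt h2]

/-- Products of square-integrable functions are integrable. -/
theorem integrable_mul_of_sq {μ : Measure X} {f g : X → ℝ}
    (hf : AEStronglyMeasurable f μ) (hg : AEStronglyMeasurable g μ)
    (hf2 : Integrable (fun x => f x ^ 2) μ) (hg2 : Integrable (fun x => g x ^ 2) μ) :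
    Integrable (fun x => f x * g x) μ := by
  refine (hf2.add hg2).mono' (hf.mul hg) (Filter.Eventually.of_forall fun x => ?_)
  rw [Real.norm_eq_abs, Pi.add_apply, abs_le]
  constructor <;> nlinarith [sq_nonneg (f x + g x), sq_nonneg (f x - g x), sq_nonneg (f x),
    sq_nonneg (g x)]

/-- Cauchy–Schwarz in the outer variable of a double integral, the square being written as a
triple integral. -/
theorem norm_integral_mul_integral_sq_le {μ : Measure X} {ν : Measure U} [SFinite μ] [SFinite ν]
    {g : U → ℂ} {k : U → X → ℂ} (hg : AEStronglyMeasurable g ν)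
    (hg2 : Integrable (fun u => ‖g u‖ ^ 2) ν)
    (hk : AEStronglyMeasurable (Function.uncurry k) (ν.prod μ))
    (hI : Integrable (fun p : U × (X × X) => k p.1 p.2.1 * conj (k p.1 p.2.2))
      (ν.prod (μ.prod μ))) :
    ‖∫ u, g u * ∫ x, k u x ∂μ ∂ν‖ ^ 2 ≤ (∫ u, ‖g u‖ ^ 2 ∂ν) *
      ‖∫ p : U × (X × X), k p.1 p.2.1 * conj (k p.1 p.2.2) ∂(ν.prod (μ.prod μ))‖ := by
  set H : U → ℂ := fun u => ∫ x, k u x ∂μ with hH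
  have hHm : AEStronglyMeasurable H ν := hk.integral_prod_right'
  have e1 : ∀ u, ∫ q : X × X, k u q.1 * conj (k u q.2) ∂(μ.prod μ) = ((‖H u‖ ^ 2 : ℝ) : ℂ) := by
    intro u
    rw [integral_prod_mul (fun x => k u x) (fun x => conj (k u x)), integral_conj,
      Complex.mul_conj, Complex.normSq_eq_norm_sq]
  have e2 : ∫ p : U × (X × X), k p.1 p.2.1 * conj (k p.1 p.2.2) ∂(ν.prod (μ.prod μ))
      = ((∫ u, ‖H u‖ ^ 2 ∂ν : ℝ) : ℂ) := by
    rw [integral_prod _ hI]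
    simp only [e1]
    exact integral_ofReal
  -- Square integrability of `H` need not be assumed: by `e1`, ‖H‖² is a marginal of the integrable
  -- triple integrand.
  have hH2 : Integrable (fun u => ‖H u‖ ^ 2) ν := by
    have := hI.integral_prod_left.norm
    simp only [e1, Complex.norm_real] at this
    simpa using this
  have h0 : 0 ≤ ∫ u, ‖H u‖ ^ 2 ∂ν := integral_nonneg fun u => sq_nonneg _
  rw [e2, Complex.norm_real, Real.norm_of_nonneg h0]
  calc ‖∫ u, g u * H u ∂ν‖ ^ 2 ≤ (∫ u, ‖g u‖ * ‖H u‖ ∂ν) ^ 2 := by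
        gcongr
        refine (norm_integral_le_integral_norm _).trans (le_of_eq ?_)
        simp only [norm_mul]
    _ ≤ _ := sq_integral_mul_le hg.norm hHm.norm hg2 hH2 (fun _ => norm_nonneg _)
        fun _ => norm_nonneg _

end CauchySchwarz

/-! ### Shears of the plane and Fubini in sheared coordinates. -/

section Shear

theorem measurePreserving_shear (c : ℝ) :
    MeasurePreserving (fun p : ℝ × ℝ => (p.1, p.2 + c * p.1)) := by
  refine MeasurePreserving.skew_product (g := fun x y => y + c * x) (MeasurePreserving.id volume)
    (by unfold Function.uncurry; fun_prop) (Filter.Eventually.of_forall fun x => ?_)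
  exact map_add_right_eq_self volume (c * x)

theorem measurableEmbedding_shear (c : ℝ) :
    MeasurableEmbedding (fun p : ℝ × ℝ => (p.1, p.2 + c * p.1)) := by
  refine MeasurableEmbedding.of_measurable_inverse (g := fun p : ℝ × ℝ => (p.1, p.2 - c * p.1))
    (by fun_prop) ?_ (by fun_prop) (fun p => by simp)
  convert MeasurableSet.univ
  refine Set.range_eq_univ.2 fun p => ⟨(p.1, p.2 - c * p.1), by simp⟩

theorem integrable_mul_shear {u v : ℝ → ℝ} (hu : Integrable u) (hv : Integrable v) (c : ℝ) :
    Integrable (fun p : ℝ × ℝ => u p.1 * v (p.2 + c * p.1)) := by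
  have h : Integrable (fun p : ℝ × ℝ => u p.1 * v p.2) := hu.mul_prod hv
  exact ((measurePreserving_shear c).integrable_comp h.aestronglyMeasurable).2 h

theorem integral_mul_shear (u v : ℝ → ℝ) (c : ℝ) :
    ∫ p : ℝ × ℝ, u p.1 * v (p.2 + c * p.1) = (∫ x, u x) * ∫ x, v x := by
  have h := (measurePreserving_shear c).integral_comp (measurableEmbedding_shear c)
    (fun p : ℝ × ℝ => u p.1 * v p.2)
  rw [h]
  exact integral_prod_mul u v

end Shear

/-! ### The truncated power weight. -/

section Weight

/-- The integrable weight `|x|^(-θ)` on `|x| ≤ ρ`. -/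
noncomputable def powWeight (ρ θ : ℝ) (x : ℝ) : ℝ :=
  (Set.Icc (-ρ) ρ).indicator (fun x => |x| ^ (-θ)) x

theorem powWeight_nonneg (ρ θ x : ℝ) : 0 ≤ powWeight ρ θ x :=
  Set.indicator_nonneg (fun _ _ => by positivity) x

theorem powWeight_neg (ρ θ x : ℝ) : powWeight ρ θ (-x) = powWeight ρ θ x := by
  unfold powWeight
  by_cases h : x ∈ Set.Icc (-ρ) ρ
  · have h' : -x ∈ Set.Icc (-ρ) ρ := ⟨by linarith [h.2], by linarith [h.1]⟩
    rw [Set.indicator_of_mem h, Set.indicator_of_mem h', abs_neg]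
  · have h' : -x ∉ Set.Icc (-ρ) ρ := fun h' => h ⟨by linarith [h'.2], by linarith [h'.1]⟩
    rw [Set.indicator_of_notMem h, Set.indicator_of_notMem h']

theorem integrable_powWeight {ρ θ : ℝ} (hρ : 0 ≤ ρ) (hθ : θ < 1) :
    Integrable (powWeight ρ θ) := by
  have hpos : IntervalIntegrable (fun x : ℝ => |x| ^ (-θ)) volume 0 ρ := by
    refine (intervalIntegral.intervalIntegrable_rpow' (by linarith : -1 < -θ)).congr ?_
    rw [Set.uIoc_of_le hρ]
    intro x hx
    simp only [abs_of_pos hx.1]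
  have hneg : IntervalIntegrable (fun x : ℝ => |x| ^ (-θ)) volume (-ρ) 0 := by
    have := ((IntervalIntegrable.iff_comp_neg).1 hpos).symm
    simpa using this
  have h := hneg.trans hpos
  rw [intervalIntegrable_iff_integrableOn_Icc_of_le (by linarith)] at h
  exact h.integrable_indicator measurableSet_Icc

end Weight

/-! ### The TT* bound for a bilinear form with decaying correlations. -/

section Hormander

theorem ae_fst_ne_snd : ∀ᵐ p : ℝ × ℝ, p.1 ≠ p.2 := by
  have hm : MeasurableSet {p : ℝ × ℝ | p.1 = p.2} := measurableSet_eq_fun (by fun_prop) (by fun_prop)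
  rw [ae_iff]
  simp only [not_not]
  rw [Measure.volume_eq_prod, Measure.measure_prod_null hm]
  refine Filter.Eventually.of_forall fun x => ?_
  have : Prod.mk x ⁻¹' {p : ℝ × ℝ | p.1 = p.2} = {x} := by
    ext y; simp [eq_comm]
  simp [this]

/-- Schur's test for the convolution kernel `powWeight`. -/
theorem schur_powWeight {G : ℝ → ℝ} (hG : Measurable G) (hG2 : Integrable (fun x => G x ^ 2))
    {ρ θ : ℝ} (hρ : 0 ≤ ρ) (hθ : θ < 1) :
    Integrable (fun p : ℝ × ℝ => |G p.1| * |G p.2| * powWeight ρ θ (p.1 - p.2)) ∧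
    ∫ p : ℝ × ℝ, |G p.1| * |G p.2| * powWeight ρ θ (p.1 - p.2) ≤
      (∫ x, G x ^ 2) * ∫ x, powWeight ρ θ x := by
  set w := powWeight ρ θ with hw
  have hwi : Integrable w := integrable_powWeight hρ hθ
  have hw0 : ∀ x, 0 ≤ w x := powWeight_nonneg ρ θ
  have hwm : Measurable w := by
    refine Measurable.indicator ?_ measurableSet_Icc
    fun_prop
  have e : ∀ p : ℝ × ℝ, w (p.1 - p.2) = w (p.2 + (-1) * p.1) := by
    intro p; rw [hw, ← powWeight_neg ρ θ (p.1 - p.2)]; congr 1; ring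
  have i1 : Integrable (fun p : ℝ × ℝ => G p.1 ^ 2 * w (p.1 - p.2)) := by
    simp only [e]
    exact integrable_mul_shear hG2 hwi (-1)
  have v1 : ∫ p : ℝ × ℝ, G p.1 ^ 2 * w (p.1 - p.2) = (∫ x, G x ^ 2) * ∫ x, w x := by
    simp only [e]
    exact integral_mul_shear (fun x => G x ^ 2) w (-1)
  have sw : ∀ p : ℝ × ℝ, G p.2 ^ 2 * w (p.1 - p.2) =
      (fun p : ℝ × ℝ => G p.1 ^ 2 * w (p.1 - p.2)) p.swap := by
    intro p
    simp only [Prod.fst_swap, Prod.snd_swap]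
    rw [hw, ← powWeight_neg ρ θ (p.1 - p.2)]; congr 2; ring
  have i2 : Integrable (fun p : ℝ × ℝ => G p.2 ^ 2 * w (p.1 - p.2)) := by
    simp only [sw]
    exact i1.swap
  have v2 : ∫ p : ℝ × ℝ, G p.2 ^ 2 * w (p.1 - p.2) = (∫ x, G x ^ 2) * ∫ x, w x := by
    simp only [sw]
    rw [← v1]
    exact integral_prod_swap (μ := (volume : Measure ℝ)) (ν := (volume : Measure ℝ))
      fun p : ℝ × ℝ => G p.1 ^ 2 * w (p.1 - p.2)
  -- Schur's test for a symmetric convolution kernel is just ab ≤ (a²+b²)/2 followed by Fubini on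
  -- each square.
  have hle : ∀ p : ℝ × ℝ, |G p.1| * |G p.2| * w (p.1 - p.2) ≤
      (1 / 2) * (G p.1 ^ 2 * w (p.1 - p.2) + G p.2 ^ 2 * w (p.1 - p.2)) := by
    intro p
    have := hw0 (p.1 - p.2)
    rw [← sq_abs (G p.1), ← sq_abs (G p.2)]
    nlinarith [mul_nonneg (sq_nonneg (|G p.1| - |G p.2|)) this]
  have i3 := (i1.add i2).const_mul (1 / 2)
  have i0 : Integrable (fun p : ℝ × ℝ => |G p.1| * |G p.2| * w (p.1 - p.2)) := by
    refine i3.mono' (by fun_prop) (Filter.Eventually.of_forall fun p => ?_)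
    rw [Real.norm_of_nonneg (mul_nonneg (by positivity) (hw0 _))]
    exact hle p
  refine ⟨i0, (integral_mono i0 i3 hle).trans (le_of_eq ?_)⟩
  simp only [Pi.add_apply]
  rw [integral_const_mul, integral_add i1 i2, v1, v2]
  ring

/-- An `L²` bound for operators whose kernel has decaying correlations. -/
theorem norm_bilinear_sq_le {F G : ℝ → ℂ} {a : ℝ → ℝ → ℂ} (hF : Measurable F) (hG : Measurable G)
    (ha : Measurable (Function.uncurry a))
    (hF2 : Integrable (fun x => ‖F x‖ ^ 2)) (hG2 : Integrable (fun x => ‖G x‖ ^ 2))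
    {R θ N : ℝ} (hR : 0 ≤ R) (hθ : θ < 1) (hN : 0 ≤ N)
    (ha1 : ∀ x y, ‖a x y‖ ≤ 1) (hsupp : ∀ x y, a x y ≠ 0 → |x| ≤ R ∧ |y| ≤ R)
    (hcor : ∀ y y', y ≠ y' → ‖∫ x, a x y * conj (a x y')‖ ≤ N * |y - y'| ^ (-θ)) :
    ‖∫ x, F x * ∫ y, G y * a x y‖ ^ 2 ≤
      (∫ x, ‖F x‖ ^ 2) * (N * ((∫ x, ‖G x‖ ^ 2) * ∫ x, powWeight (2 * R) θ x)) := by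
  -- The support of `a` makes this truncation harmless, and on a bounded interval L² functions are
  -- integrable; this is what makes the triple integrand absolutely integrable.
  set G₁ : ℝ → ℂ := (Set.Icc (-R) R).indicator G with hG₁
  have hGm : Measurable G₁ := hG.indicator measurableSet_Icc
  have hGi : Integrable G₁ := by
    have hr : Integrable (fun y => G₁ y) (volume.restrict (Set.Icc (-R) R)) := by
      have h2 : MemLp G 2 (volume.restrict (Set.Icc (-R) R)) :=
        ((memLp_two_iff_integrable_sq_norm hG.aestronglyMeasurable).2 hG2).restrict _
      have h3 : Integrable G (volume.restrict (Set.Icc (-R) R)) := h2.integrable (by norm_num)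
      refine h3.congr ?_
      filter_upwards [ae_restrict_mem measurableSet_Icc] with y hy
      rw [hG₁, Set.indicator_of_mem hy]
    have : IntegrableOn G₁ (Set.Icc (-R) R) := hr
    rw [← integrable_indicator_iff measurableSet_Icc] at this
    rwa [hG₁, Set.indicator_indicator, Set.inter_self] at this
  have hGa : ∀ x y, G y * a x y = G₁ y * a x y := by
    intro x y
    by_cases h : a x y = 0
    · simp [h]
    · rw [hG₁, Set.indicator_of_mem (Set.mem_Icc.2 (abs_le.1 (hsupp x y h).2))]
  simp only [hGa]
  have ham : ∀ {s : ℝ × (ℝ × ℝ) → ℝ} {t : ℝ × (ℝ × ℝ) → ℝ}, Measurable s → Measurable t →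
      Measurable fun p => a (s p) (t p) := by
    intro s t hs ht
    exact ha.comp (hs.prodMk ht)
  have hI : Integrable (fun p : ℝ × (ℝ × ℝ) =>
      (G₁ p.2.1 * a p.1 p.2.1) * conj (G₁ p.2.2 * a p.1 p.2.2)) := by
    have d : Integrable (fun p : ℝ × (ℝ × ℝ) =>
        (Set.Icc (-R) R).indicator (fun _ => (1 : ℝ)) p.1 * (‖G₁ p.2.1‖ * ‖G₁ p.2.2‖)) := by
      refine Integrable.mul_prod (μ := volume) (ν := volume)
        (f := (Set.Icc (-R) R).indicator (fun _ => (1 : ℝ)))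
        (g := fun q : ℝ × ℝ => ‖G₁ q.1‖ * ‖G₁ q.2‖) ?_ (hGi.norm.mul_prod hGi.norm)
      exact (integrableOn_const (by simp) (by simp)).integrable_indicator measurableSet_Icc
    have m1 : Measurable fun p : ℝ × (ℝ × ℝ) => a p.1 p.2.1 := ham (by fun_prop) (by fun_prop)
    have m2 : Measurable fun p : ℝ × (ℝ × ℝ) => a p.1 p.2.2 := ham (by fun_prop) (by fun_prop)
    refine d.mono' ?_ (Filter.Eventually.of_forall fun p => ?_)
    · refine (Measurable.mul (by fun_prop) ?_).aestronglyMeasurable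
      exact Complex.continuous_conj.measurable.comp (by fun_prop)
    · by_cases h : a p.1 p.2.1 = 0
      · simp only [h, mul_zero, zero_mul, norm_zero]
        exact mul_nonneg (Set.indicator_nonneg (fun _ _ => zero_le_one) _) (by positivity)
      · rw [Set.indicator_of_mem (Set.mem_Icc.2 (abs_le.1 (hsupp _ _ h).1)), one_mul, norm_mul, RCLike.norm_conj,
          norm_mul, norm_mul]
        have h1 := ha1 p.1 p.2.1
        have h2 := ha1 p.1 p.2.2
        gcongr
        · exact mul_le_of_le_one_right (norm_nonneg _) h1
        · exact mul_le_of_le_one_right (norm_nonneg _) h2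
  have hkm : AEStronglyMeasurable (Function.uncurry fun x y => G₁ y * a x y)
      ((volume : Measure ℝ).prod volume) := by
    refine Measurable.aestronglyMeasurable ?_
    exact (hGm.comp measurable_snd).mul ha
  refine (norm_integral_mul_integral_sq_le (k := fun x y => G₁ y * a x y)
    hF.aestronglyMeasurable hF2 hkm hI).trans ?_
  refine mul_le_mul_of_nonneg_left ?_ (integral_nonneg fun x => sq_nonneg _)
  have hG₁2 : ∀ x, ‖G₁ x‖ ^ 2 ≤ ‖G x‖ ^ 2 := fun x => by
    gcongr
    exact norm_indicator_le_norm_self _ _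
  have hGi2 : Integrable (fun x => ‖G₁ x‖ ^ 2) :=
    hG2.mono' (by fun_prop) (Filter.Eventually.of_forall fun x => by
      rw [Real.norm_of_nonneg (sq_nonneg _)]; exact hG₁2 x)
  obtain ⟨s1, s2⟩ := schur_powWeight (G := fun x => ‖G₁ x‖) (by fun_prop) hGi2
    (ρ := 2 * R) (by linarith) hθ
  have hstep : ‖∫ p : ℝ × (ℝ × ℝ), (G₁ p.2.1 * a p.1 p.2.1) * conj (G₁ p.2.2 * a p.1 p.2.2)‖ ≤
      ∫ q : ℝ × ℝ, N * (|‖G₁ q.1‖| * |‖G₁ q.2‖| * powWeight (2 * R) θ (q.1 - q.2)) := by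
    rw [Measure.volume_eq_prod, integral_prod_symm _ hI]
    refine norm_integral_le_of_norm_le (s1.const_mul N) ?_
    filter_upwards [ae_fst_ne_snd] with q hq
    have e : ∀ x, (G₁ q.1 * a x q.1) * conj (G₁ q.2 * a x q.2) =
        (G₁ q.1 * conj (G₁ q.2)) * (a x q.1 * conj (a x q.2)) := by
      intro x; rw [map_mul]; ring
    simp only [e, abs_norm]
    rw [integral_const_mul, norm_mul, norm_mul, RCLike.norm_conj]
    by_cases h1 : |q.1| ≤ R ∧ |q.2| ≤ R
    · have hmem : q.1 - q.2 ∈ Set.Icc (-(2 * R)) (2 * R) := by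
        have := abs_le.1 h1.1; have := abs_le.1 h1.2
        constructor <;> linarith
      rw [powWeight, Set.indicator_of_mem hmem]
      calc _ ≤ ‖G₁ q.1‖ * ‖G₁ q.2‖ * (N * |q.1 - q.2| ^ (-θ)) := by
            gcongr
            exact hcor _ _ hq
        _ = _ := by ring
    · have : ‖G₁ q.1‖ * ‖G₁ q.2‖ = 0 := by
        by_cases h3 : |q.1| ≤ R
        · have h4 : q.2 ∉ Set.Icc (-R) R := fun h => h1 ⟨h3, abs_le.2 h⟩
          rw [hG₁, Set.indicator_of_notMem h4]; simp
        · have h4 : q.1 ∉ Set.Icc (-R) R := fun h => h3 (abs_le.2 h)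
          rw [hG₁, Set.indicator_of_notMem h4]; simp
      rw [this]
      simp
  refine hstep.trans ?_
  rw [integral_const_mul]
  refine mul_le_mul_of_nonneg_left (s2.trans ?_) hN
  refine mul_le_mul_of_nonneg_right ?_ (integral_nonneg (powWeight_nonneg _ _))
  exact integral_mono hGi2 hG2 hG₁2

end Hormander

/-! ### Absolute convergence and the bound without oscillation. -/

section Trivial

theorem integrable_indicator_norm_of_pow_four {f : ℝ → ℂ} (hf : Measurable f)
    (h4 : Integrable (fun x => ‖f x‖ ^ 4)) (R : ℝ) :
    Integrable ((Set.Icc (-R) R).indicator fun x => ‖f x‖) := by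
  have h1 : Integrable ((Set.Icc (-R) R).indicator fun _ : ℝ => (1 : ℝ)) :=
    (integrableOn_const (by simp) (by simp)).integrable_indicator measurableSet_Icc
  refine (h1.add h4).mono' ((hf.norm.indicator measurableSet_Icc).aestronglyMeasurable)
    (Filter.Eventually.of_forall fun x => ?_)
  by_cases hx : x ∈ Set.Icc (-R) R
  · simp only [Set.indicator_of_mem hx, Pi.add_apply, norm_norm]
    nlinarith [sq_nonneg (‖f x‖ ^ 2 - 1), sq_nonneg (‖f x‖ - 1), norm_nonneg (f x),
      sq_nonneg (‖f x‖ - 1 / 2)]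
  · simp only [Set.indicator_of_notMem hx, Pi.add_apply, norm_zero]
    positivity

/-- Hölder's inequality between `L¹(-R, R)` and `L⁴`. -/
theorem integral_indicator_norm_pow_four_le {f : ℝ → ℂ} (hf : Measurable f)
    (h4 : Integrable (fun x => ‖f x‖ ^ 4)) {R : ℝ} (hR : 0 ≤ R) :
    (∫ x, (Set.Icc (-R) R).indicator (fun x => ‖f x‖) x) ^ 4 ≤
      (2 * R) ^ 3 * ∫ x, ‖f x‖ ^ 4 := by
  set s : ℝ → ℝ := (Set.Icc (-R) R).indicator fun _ => (1 : ℝ) with hs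
  set u : ℝ → ℝ := (Set.Icc (-R) R).indicator (fun x => ‖f x‖) with hu
  have hsm : Measurable s := measurable_const.indicator measurableSet_Icc
  have hum : Measurable u := hf.norm.indicator measurableSet_Icc
  have hs0 : ∀ x, 0 ≤ s x := fun x => Set.indicator_nonneg (fun _ _ => zero_le_one) x
  have hu0 : ∀ x, 0 ≤ u x := fun x => Set.indicator_nonneg (fun _ _ => norm_nonneg _) x
  have hss : ∀ x, s x ^ 2 = s x := by
    intro x; by_cases hx : x ∈ Set.Icc (-R) R <;> simp [hs, hx]
  have hsu : ∀ x, s x * u x = u x := by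
    intro x; by_cases hx : x ∈ Set.Icc (-R) R <;> simp [hs, hu, hx]
  have hsu2 : ∀ x, s x * u x ^ 2 = u x ^ 2 := by
    intro x; rw [pow_two, ← mul_assoc, hsu]
  have hsi : Integrable s :=
    (integrableOn_const (by simp) (by simp)).integrable_indicator measurableSet_Icc
  have hsv : ∫ x, s x = 2 * R := by
    rw [hs, integral_indicator measurableSet_Icc]
    simp [hR]
    ring_nf
  have hu4 : ∀ x, u x ^ 4 ≤ ‖f x‖ ^ 4 := by
    intro x
    refine pow_le_pow_left₀ (hu0 x) ?_ 4
    exact Set.indicator_le_self' (fun _ _ => norm_nonneg _) x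
  have hu4i : Integrable fun x => u x ^ 4 :=
    h4.mono' (by fun_prop) (Filter.Eventually.of_forall fun x => by
      rw [Real.norm_of_nonneg (pow_nonneg (hu0 x) 4)]; exact hu4 x)
  have hu2i : Integrable fun x => u x ^ 2 := by
    refine (hsi.add hu4i).mono' (by fun_prop) (Filter.Eventually.of_forall fun x => ?_)
    rw [Real.norm_of_nonneg (sq_nonneg _), Pi.add_apply, ← hsu2]
    nlinarith [hs0 x, hss x, hsu2 x, sq_nonneg (u x ^ 2 - s x), sq_nonneg (u x ^ 2)]
  -- Cauchy–Schwarz against the indicator, applied twice: from L¹ to L², then from L² to L⁴.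
  have c1 := sq_integral_mul_le hsm.aestronglyMeasurable (μ := volume) hum.aestronglyMeasurable
    (by simpa only [hss] using hsi) hu2i hs0 hu0
  have c2 := sq_integral_mul_le hsm.aestronglyMeasurable (μ := volume)
    (g := fun x => u x ^ 2) (by fun_prop)
    (by simpa only [hss] using hsi) (by simpa only [← pow_mul] using hu4i) hs0
    (fun x => sq_nonneg _)
  simp only [hsu, hss, hsu2, hsv, ← pow_mul] at c1 c2
  have n1 : 0 ≤ ∫ x, u x ^ 2 := integral_nonneg fun x => sq_nonneg _
  have n2 : ∫ x, u x ^ (2 * 2) ≤ ∫ x, ‖f x‖ ^ 4 := integral_mono hu4i h4 hu4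
  calc (∫ x, u x) ^ 4 = ((∫ x, u x) ^ 2) ^ 2 := by ring
    _ ≤ (2 * R * ∫ x, u x ^ 2) ^ 2 := by gcongr
    _ = (2 * R) ^ 2 * (∫ x, u x ^ 2) ^ 2 := by ring
    _ ≤ (2 * R) ^ 2 * (2 * R * ∫ x, ‖f x‖ ^ 4) := by
        gcongr
        exact c2.trans (by gcongr)
    _ = _ := by ring

variable {f₁ f₂ f₃ : ℝ → ℂ} {e : ℝ → ℝ → ℂ}

theorem norm_trilinear_integrand_le {R : ℝ} (he1 : ∀ x y, ‖e x y‖ ≤ 1)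
    (hsupp : ∀ x y, e x y ≠ 0 → |x| ≤ R ∧ |y| ≤ R) (ε : ℝ) (p : ℝ × ℝ) :
    ‖f₁ p.1 * f₂ p.2 * f₃ (ε * p.1 + p.2) * e p.1 p.2‖ ≤
      (Set.Icc (-R) R).indicator (fun x => ‖f₁ x‖) p.1 * (‖f₂ p.2‖ * ‖f₃ (ε * p.1 + p.2)‖) := by
  by_cases h : e p.1 p.2 = 0
  · rw [h, mul_zero, norm_zero]
    exact mul_nonneg (Set.indicator_nonneg (fun _ _ => norm_nonneg _) _) (by positivity)
  · rw [Set.indicator_of_mem (Set.mem_Icc.2 (abs_le.1 (hsupp _ _ h).1))]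
    simp only [norm_mul]
    rw [mul_assoc ‖f₁ p.1‖]
    exact mul_le_of_le_one_right (by positivity) (he1 _ _)

theorem integrable_trilinear_majorant (hf₁ : Measurable f₁) (hf₂ : Measurable f₂)
    (hf₃ : Measurable f₃)
    (h₁ : Integrable (fun x => ‖f₁ x‖ ^ 4)) (h₂ : Integrable (fun x => ‖f₂ x‖ ^ 2))
    (h₃ : Integrable (fun x => ‖f₃ x‖ ^ 2)) (R ε : ℝ) :
    Integrable fun p : ℝ × ℝ =>
      (Set.Icc (-R) R).indicator (fun x => ‖f₁ x‖) p.1 * (‖f₂ p.2‖ * ‖f₃ (ε * p.1 + p.2)‖) := by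
  set u : ℝ → ℝ := (Set.Icc (-R) R).indicator (fun x => ‖f₁ x‖) with hu
  have hui : Integrable u := integrable_indicator_norm_of_pow_four hf₁ h₁ R
  have hum : Measurable u := hf₁.norm.indicator measurableSet_Icc
  have hu0 : ∀ x, 0 ≤ u x := fun x => Set.indicator_nonneg (fun _ _ => norm_nonneg _) x
  have i1 : Integrable fun p : ℝ × ℝ => u p.1 * ‖f₂ p.2‖ ^ 2 := hui.mul_prod h₂
  have i2 : Integrable fun p : ℝ × ℝ => u p.1 * ‖f₃ (ε * p.1 + p.2)‖ ^ 2 := by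
    simpa only [add_comm] using integrable_mul_shear hui h₃ ε
  refine (i1.add i2).mono' (by fun_prop) (Filter.Eventually.of_forall fun p => ?_)
  rw [Real.norm_of_nonneg (mul_nonneg (hu0 _) (by positivity)), Pi.add_apply, ← mul_add]
  refine mul_le_mul_of_nonneg_left ?_ (hu0 _)
  nlinarith [sq_nonneg (‖f₂ p.2‖ - ‖f₃ (ε * p.1 + p.2)‖), sq_nonneg (‖f₂ p.2‖),
    sq_nonneg ‖f₃ (ε * p.1 + p.2)‖]

theorem integrable_trilinear (hf₁ : Measurable f₁) (hf₂ : Measurable f₂)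
    (hf₃ : Measurable f₃) (he : Measurable (Function.uncurry e))
    (h₁ : Integrable (fun x => ‖f₁ x‖ ^ 4)) (h₂ : Integrable (fun x => ‖f₂ x‖ ^ 2))
    (h₃ : Integrable (fun x => ‖f₃ x‖ ^ 2)) {R : ℝ} (he1 : ∀ x y, ‖e x y‖ ≤ 1)
    (hsupp : ∀ x y, e x y ≠ 0 → |x| ≤ R ∧ |y| ≤ R) (ε : ℝ) :
    Integrable fun p : ℝ × ℝ => f₁ p.1 * f₂ p.2 * f₃ (ε * p.1 + p.2) * e p.1 p.2 := by
  refine (integrable_trilinear_majorant hf₁ hf₂ hf₃ h₁ h₂ h₃ R ε).mono' ?_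
    (Filter.Eventually.of_forall (norm_trilinear_integrand_le he1 hsupp ε))
  exact (Measurable.mul (by fun_prop) he).aestronglyMeasurable

/-- The bound of the trilinear form that ignores oscillation. -/
theorem norm_trilinear_pow_four_le_trivial (hf₁ : Measurable f₁) (hf₂ : Measurable f₂)
    (hf₃ : Measurable f₃)
    (h₁ : Integrable (fun x => ‖f₁ x‖ ^ 4)) (h₂ : Integrable (fun x => ‖f₂ x‖ ^ 2))
    (h₃ : Integrable (fun x => ‖f₃ x‖ ^ 2)) {R : ℝ} (hR : 0 ≤ R) (he1 : ∀ x y, ‖e x y‖ ≤ 1)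
    (hsupp : ∀ x y, e x y ≠ 0 → |x| ≤ R ∧ |y| ≤ R) (ε : ℝ) :
    ‖∫ p : ℝ × ℝ, f₁ p.1 * f₂ p.2 * f₃ (ε * p.1 + p.2) * e p.1 p.2‖ ^ 4 ≤
      (2 * R) ^ 3 * (∫ x, ‖f₁ x‖ ^ 4) * (∫ x, ‖f₂ x‖ ^ 2) ^ 2 * (∫ x, ‖f₃ x‖ ^ 2) ^ 2 := by
  have hM := integrable_trilinear_majorant hf₁ hf₂ hf₃ h₁ h₂ h₃ R ε
  have b1 := norm_integral_le_of_norm_le hM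
    (Filter.Eventually.of_forall (norm_trilinear_integrand_le (f₁ := f₁) (f₂ := f₂) (f₃ := f₃)
      he1 hsupp ε))
  have hui : Integrable ((Set.Icc (-R) R).indicator (fun x => ‖f₁ x‖)) :=
    integrable_indicator_norm_of_pow_four hf₁ h₁ R
  have b2 := integral_indicator_norm_pow_four_le hf₁ h₁ hR
  set u : ℝ → ℝ := (Set.Icc (-R) R).indicator (fun x => ‖f₁ x‖) with hu
  have hu0 : ∀ x, 0 ≤ u x := fun x => Set.indicator_nonneg (fun _ _ => norm_nonneg _) x
  set P := (∫ x, ‖f₂ x‖ ^ 2) * ∫ x, ‖f₃ x‖ ^ 2 with hP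
  have n2 : 0 ≤ ∫ x, ‖f₂ x‖ ^ 2 := integral_nonneg fun x => sq_nonneg _
  have n3 : 0 ≤ ∫ x, ‖f₃ x‖ ^ 2 := integral_nonneg fun x => sq_nonneg _
  have hP0 : 0 ≤ P := mul_nonneg n2 n3
  -- For fixed ξ, Cauchy–Schwarz in η and translation invariance give ‖f₂‖₂‖f₃‖₂ whatever `ε` is;
  -- only the L¹ norm of the truncated `f₁` remains.
  have b3 : ∫ p : ℝ × ℝ, u p.1 * (‖f₂ p.2‖ * ‖f₃ (ε * p.1 + p.2)‖) ≤ (∫ x, u x) * √P := by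
    rw [Measure.volume_eq_prod, integral_prod _ hM, ← integral_mul_const]
    refine integral_mono hM.integral_prod_left (hui.mul_const _) fun x => ?_
    simp only
    rw [integral_const_mul]
    refine mul_le_mul_of_nonneg_left ?_ (hu0 x)
    have h3' : Integrable fun y => ‖f₃ (ε * x + y)‖ ^ 2 := h₃.comp_add_left (ε * x)
    have := sq_integral_mul_le (μ := volume) (f := fun y => ‖f₂ y‖)
      (g := fun y => ‖f₃ (ε * x + y)‖) (by fun_prop)
      (Measurable.aestronglyMeasurable (by fun_prop)) h₂ h3'
      (fun _ => norm_nonneg _) (fun _ => norm_nonneg _)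
    rw [integral_add_left_eq_self (fun y => ‖f₃ y‖ ^ 2) (ε * x)] at this
    exact Real.le_sqrt_of_sq_le this
  calc _ ≤ ((∫ x, u x) * √P) ^ 4 := by gcongr; exact b1.trans b3
    _ = (∫ x, u x) ^ 4 * ((√P) ^ 2) ^ 2 := by ring
    _ = (∫ x, u x) ^ 4 * P ^ 2 := by rw [Real.sq_sqrt hP0]
    _ ≤ ((2 * R) ^ 3 * ∫ x, ‖f₁ x‖ ^ 4) * P ^ 2 := by gcongr
    _ = _ := by rw [hP]; ring

end Trivial

/-! ### Difference variables in the triple integral. -/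

section Triple

/-- This passes from (τ, x, y) to (u, x, x') with u = y + εx and x' = x + τ, the variables produced
by the first Cauchy–Schwarz; the map is a composition of shears and coordinate permutations. -/
theorem measurePreserving_triple (ε : ℝ) :
    MeasurePreserving (fun p : ℝ × (ℝ × ℝ) => (p.2.2 + ε * p.2.1, (p.2.1, p.1 + p.2.1))) := by
  have s1 : MeasurePreserving (Prod.swap : ℝ × (ℝ × ℝ) → (ℝ × ℝ) × ℝ) :=
    Measure.measurePreserving_swap
  have s2 : MeasurePreserving (fun p : (ℝ × ℝ) × ℝ =>
      ((p.1.1, p.1.2 + ε * p.1.1), p.2 + p.1.1)) := by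
    refine MeasurePreserving.skew_product (f := fun q : ℝ × ℝ => (q.1, q.2 + ε * q.1))
      (g := fun q y => y + q.1)
      (measurePreserving_shear ε) (by unfold Function.uncurry; fun_prop)
      (Filter.Eventually.of_forall fun x => ?_)
    exact map_add_right_eq_self volume x.1
  have s3 : MeasurePreserving (fun p : (ℝ × ℝ) × ℝ => ((p.1.2, p.1.1), p.2)) :=
    MeasurePreserving.prod (f := (Prod.swap : ℝ × ℝ → ℝ × ℝ)) (g := (id : ℝ → ℝ))
      Measure.measurePreserving_swap (MeasurePreserving.id volume)
  have s4 : MeasurePreserving (MeasurableEquiv.prodAssoc : (ℝ × ℝ) × ℝ ≃ᵐ ℝ × (ℝ × ℝ)) :=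
    measurePreserving_prodAssoc volume volume volume
  exact s4.comp (s3.comp (s2.comp s1))

theorem measurableEmbedding_triple (ε : ℝ) :
    MeasurableEmbedding
      (fun p : ℝ × (ℝ × ℝ) => (p.2.2 + ε * p.2.1, (p.2.1, p.1 + p.2.1))) := by
  refine MeasurableEmbedding.of_measurable_inverse
    (g := fun p : ℝ × (ℝ × ℝ) => (p.2.2 - p.2.1, (p.2.1, p.1 - ε * p.2.1)))
    (by fun_prop) ?_ (by fun_prop) (fun p => by simp)
  convert MeasurableSet.univ
  refine Set.range_eq_univ.2 fun p => ⟨(p.2.2 - p.2.1, (p.2.1, p.1 - ε * p.2.1)), by simp⟩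

/-- With `v` = ‖f₂‖², this and the primed version dominate the squared kernel once the product of
the two values of ‖f₂‖ is split by ab ≤ a² + b². -/
theorem integrable_triple_majorant {u v : ℝ → ℝ} (hu : Integrable u) (hv : Integrable v) (ε : ℝ) :
    Integrable fun p : ℝ × (ℝ × ℝ) => u p.2.1 * u p.2.2 * v (p.1 - ε * p.2.1) := by
  have h1 : Integrable (fun p : ℝ × ℝ => u p.1 * v (p.2 + (-ε) * p.1)) :=
    integrable_mul_shear hu hv (-ε)
  have h2 : Integrable (fun p : ℝ × ℝ => u p.2 * v (p.1 + (-ε) * p.2)) := h1.swap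
  have h3 : Integrable (fun p : (ℝ × ℝ) × ℝ => (u p.1.2 * v (p.1.1 + (-ε) * p.1.2)) * u p.2) :=
    h2.mul_prod hu
  have s4 : MeasurePreserving (MeasurableEquiv.prodAssoc : (ℝ × ℝ) × ℝ ≃ᵐ ℝ × (ℝ × ℝ)) :=
    measurePreserving_prodAssoc volume volume volume
  have h4 := ((s4.symm).integrable_comp h3.aestronglyMeasurable).2 h3
  refine h4.congr (Filter.Eventually.of_forall fun p => ?_)
  simp only [Function.comp, MeasurableEquiv.prodAssoc, MeasurableEquiv.symm_mk,
    MeasurableEquiv.coe_mk, Equiv.prodAssoc_symm_apply]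
  rw [show p.1 + -ε * p.2.1 = p.1 - ε * p.2.1 by ring]
  ring

theorem integrable_triple_majorant' {u v : ℝ → ℝ} (hu : Integrable u) (hv : Integrable v) (ε : ℝ) :
    Integrable fun p : ℝ × (ℝ × ℝ) => u p.2.1 * u p.2.2 * v (p.1 - ε * p.2.2) := by
  have h1 := integrable_triple_majorant hu hv ε
  have s : MeasurePreserving (fun p : ℝ × (ℝ × ℝ) => (p.1, (p.2.2, p.2.1))) :=
    MeasurePreserving.prod (f := (id : ℝ → ℝ)) (g := (Prod.swap : ℝ × ℝ → ℝ × ℝ))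
      (MeasurePreserving.id volume) Measure.measurePreserving_swap
  refine ((s.integrable_comp h1.aestronglyMeasurable).2 h1).congr
    (Filter.Eventually.of_forall fun p => ?_)
  simp only [Function.comp]
  ring

/-- The `L²` norms of `x ↦ v(x) v(x - ε τ)` are square integrable in `τ`. -/
theorem integrable_mul_comp_sub {v : ℝ → ℝ} (hvm : Measurable v) (hv : Integrable v)
    (hv0 : ∀ x, 0 ≤ v x) {ε : ℝ} (hε : ε ≠ 0) :
    Integrable (fun p : ℝ × ℝ => v p.2 * v (p.2 - ε * p.1)) ∧
      ∫ p : ℝ × ℝ, v p.2 * v (p.2 - ε * p.1) = |ε|⁻¹ * (∫ x, v x) ^ 2 := by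
  -- Rescaling t by ε costs |ε|⁻¹. This is the factor of size 2^j that the oscillation has to beat.
  have hin : ∀ y, ∫ t, v y * v (y - ε * t) = v y * (|ε|⁻¹ * ∫ x, v x) := by
    intro y
    rw [integral_const_mul]
    have := Measure.integral_comp_mul_left (fun t => v (y - t)) ε
    rw [this, integral_sub_left_eq_self v volume y, abs_inv, smul_eq_mul]
  have hint : ∀ y, Integrable fun t => v y * v (y - ε * t) := by
    intro y
    refine Integrable.const_mul ?_ _
    exact (hv.comp_sub_left y).comp_mul_left' hε
  have hI : Integrable (fun p : ℝ × ℝ => v p.1 * v (p.1 - ε * p.2)) := by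
    rw [Measure.volume_eq_prod, integrable_prod_iff (by fun_prop)]
    refine ⟨Filter.Eventually.of_forall hint, ?_⟩
    have : ∀ y t, ‖v y * v (y - ε * t)‖ = v y * v (y - ε * t) := fun y t =>
      Real.norm_of_nonneg (mul_nonneg (hv0 _) (hv0 _))
    simp only [this, hin]
    exact hv.mul_const _
  have hI' : Integrable (fun p : ℝ × ℝ => v p.2 * v (p.2 - ε * p.1)) := hI.swap
  refine ⟨hI', ?_⟩
  rw [Measure.volume_eq_prod, integral_prod_symm _ hI']
  simp only [hin]
  rw [integral_mul_const]
  ring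

end Triple

/-! ### From correlation decay to the trilinear bound. -/

section Trilinear

variable {f₁ f₂ f₃ : ℝ → ℂ} {e : ℝ → ℝ → ℂ}

/-- The L⁴ norm of `f₁` enters here: a²b² ≤ (a⁴+b⁴)/2 and translation invariance make the bound
uniform in `τ`. -/
theorem integrable_mul_sq_translate {f : ℝ → ℂ} (hf : Measurable f)
    (h4 : Integrable (fun x => ‖f x‖ ^ 4)) (τ : ℝ) :
    Integrable (fun x => ‖f x * conj (f (x + τ))‖ ^ 2) ∧
      ∫ x, ‖f x * conj (f (x + τ))‖ ^ 2 ≤ ∫ x, ‖f x‖ ^ 4 := by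
  have h4' : Integrable fun x => ‖f (x + τ)‖ ^ 4 := h4.comp_add_right τ
  have hle : ∀ x, ‖f x * conj (f (x + τ))‖ ^ 2 ≤ (1 / 2) * (‖f x‖ ^ 4 + ‖f (x + τ)‖ ^ 4) := by
    intro x
    rw [norm_mul, RCLike.norm_conj]
    nlinarith [sq_nonneg (‖f x‖ ^ 2 - ‖f (x + τ)‖ ^ 2)]
  have hb := (h4.add h4').const_mul (1 / 2)
  have hc : Measurable fun x => conj (f (x + τ)) :=
    Complex.continuous_conj.measurable.comp (by fun_prop)
  have hi : Integrable (fun x => ‖f x * conj (f (x + τ))‖ ^ 2) :=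
    hb.mono' (Measurable.aestronglyMeasurable (by fun_prop))
      (Filter.Eventually.of_forall fun x => by
        rw [Real.norm_of_nonneg (sq_nonneg _)]; exact hle x)
  refine ⟨hi, (integral_mono hi hb hle).trans (le_of_eq ?_)⟩
  simp only [Pi.add_apply]
  rw [integral_const_mul, integral_add h4 h4', integral_add_right_eq_self (fun x => ‖f x‖ ^ 4) τ]
  ring

/-- The trilinear form decays if the fourfold correlations of its kernel do. -/
theorem norm_trilinear_pow_four_le (hf₁ : Measurable f₁) (hf₂ : Measurable f₂)
    (hf₃ : Measurable f₃) (he : Measurable (Function.uncurry e))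
    (h₁ : Integrable (fun x => ‖f₁ x‖ ^ 4)) (h₂ : Integrable (fun x => ‖f₂ x‖ ^ 2))
    (h₃ : Integrable (fun x => ‖f₃ x‖ ^ 2)) {R θ B ε : ℝ} (hR : 0 ≤ R) (hθ : θ < 1)
    (hB : 0 ≤ B) (hε : ε ≠ 0) (he1 : ∀ x y, ‖e x y‖ ≤ 1)
    (hsupp : ∀ x y, e x y ≠ 0 → |x| ≤ R ∧ |y| ≤ R)
    (hcor : ∀ τ, τ ≠ 0 → ∀ y y', y ≠ y' →
      ‖∫ x, (e x y * conj (e (x + τ) (y - ε * τ))) *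
        conj (e x y' * conj (e (x + τ) (y' - ε * τ)))‖ ≤ B * |τ| ^ (-θ) * |y - y'| ^ (-θ)) :
    ‖∫ p : ℝ × ℝ, f₁ p.1 * f₂ p.2 * f₃ (ε * p.1 + p.2) * e p.1 p.2‖ ^ 4 ≤
      (B * (∫ x, powWeight (2 * R) θ x) ^ 2 * |ε|⁻¹) *
        (∫ x, ‖f₁ x‖ ^ 4) * (∫ x, ‖f₂ x‖ ^ 2) ^ 2 * (∫ x, ‖f₃ x‖ ^ 2) ^ 2 := by
  set κ := ∫ x, powWeight (2 * R) θ x with hκ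
  have hκ0 : 0 ≤ κ := integral_nonneg (powWeight_nonneg _ _)
  set M := ∫ x, ‖f₁ x‖ ^ 4 with hM
  have hM0 : 0 ≤ M := integral_nonneg fun x => by positivity
  have hconj : ∀ {Y : Type} [MeasurableSpace Y] {g : Y → ℂ}, Measurable g →
      Measurable fun y => conj (g y) := fun hg => Complex.continuous_conj.measurable.comp hg
  have hem : ∀ {Y : Type} [MeasurableSpace Y] {s t : Y → ℝ}, Measurable s → Measurable t →
      Measurable fun y => e (s y) (t y) := fun hs ht => he.comp (hs.prodMk ht)
  set k : ℝ → ℝ → ℂ := fun u x => f₁ x * f₂ (u - ε * x) * e x (u - ε * x) with hk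
  -- the form as an iterated integral
  have hΨ := integrable_trilinear hf₁ hf₂ hf₃ he h₁ h₂ h₃ he1 hsupp ε
  have hform : ∫ p : ℝ × ℝ, f₁ p.1 * f₂ p.2 * f₃ (ε * p.1 + p.2) * e p.1 p.2 =
      ∫ u, f₃ u * ∫ x, k u x := by
    have hs := measurePreserving_shear (-ε)
    have hc := hs.integral_comp (measurableEmbedding_shear (-ε))
      (fun p : ℝ × ℝ => f₁ p.1 * f₂ p.2 * f₃ (ε * p.1 + p.2) * e p.1 p.2)
    have hi := (hs.integrable_comp hΨ.aestronglyMeasurable).2 hΨ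
    rw [← hc]
    refine (integral_prod_symm _ hi).trans ?_
    refine integral_congr_ae (Filter.Eventually.of_forall fun u => ?_)
    simp only [Function.comp]
    rw [← integral_const_mul]
    refine integral_congr_ae (Filter.Eventually.of_forall fun x => ?_)
    simp only [hk]
    rw [show ε * x + (u + -ε * x) = u by ring, show u + -ε * x = u - ε * x by ring]
    ring
  -- integrability of the triple integrand
  set I : ℝ × (ℝ × ℝ) → ℂ := fun p => k p.1 p.2.1 * conj (k p.1 p.2.2) with hIdef
  have hkm : Measurable (Function.uncurry k) := by
    refine Measurable.mul (by fun_prop) (hem (by fun_prop) (by fun_prop))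
  have hk2 : ∀ {Y : Type} [MeasurableSpace Y] {s t : Y → ℝ}, Measurable s → Measurable t →
      Measurable fun y => k (s y) (t y) := fun hs ht => hkm.comp (hs.prodMk ht)
  have hIm : Measurable I :=
    (hk2 (by fun_prop) (by fun_prop)).mul (hconj (hk2 (by fun_prop) (by fun_prop)))
  set u : ℝ → ℝ := (Set.Icc (-R) R).indicator (fun x => ‖f₁ x‖) with hu
  have hui : Integrable u := integrable_indicator_norm_of_pow_four hf₁ h₁ R
  have hu0 : ∀ x, 0 ≤ u x := fun x => Set.indicator_nonneg (fun _ _ => norm_nonneg _) x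
  have hkle : ∀ s x, ‖k s x‖ ≤ u x * ‖f₂ (s - ε * x)‖ := by
    intro s x
    by_cases h : e x (s - ε * x) = 0
    · simp only [hk, h, mul_zero, norm_zero]
      exact mul_nonneg (hu0 _) (norm_nonneg _)
    · rw [hu, Set.indicator_of_mem (Set.mem_Icc.2 (abs_le.1 (hsupp _ _ h).1))]
      simp only [hk, norm_mul]
      exact mul_le_of_le_one_right (by positivity) (he1 _ _)
  have hI : Integrable I := by
    refine ((integrable_triple_majorant hui h₂ ε).add
      (integrable_triple_majorant' hui h₂ ε)).mono' hIm.aestronglyMeasurable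
      (Filter.Eventually.of_forall fun p => ?_)
    simp only [hIdef, norm_mul, RCLike.norm_conj, Pi.add_apply]
    have a1 := hkle p.1 p.2.1
    have a2 := hkle p.1 p.2.2
    calc ‖k p.1 p.2.1‖ * ‖k p.1 p.2.2‖
        ≤ (u p.2.1 * ‖f₂ (p.1 - ε * p.2.1)‖) * (u p.2.2 * ‖f₂ (p.1 - ε * p.2.2)‖) := by
          gcongr
          exact mul_nonneg (hu0 _) (norm_nonneg _)
      _ = (u p.2.1 * u p.2.2) * (‖f₂ (p.1 - ε * p.2.1)‖ * ‖f₂ (p.1 - ε * p.2.2)‖) := by ring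
      _ ≤ (u p.2.1 * u p.2.2) * (‖f₂ (p.1 - ε * p.2.1)‖ ^ 2 + ‖f₂ (p.1 - ε * p.2.2)‖ ^ 2) := by
          refine mul_le_mul_of_nonneg_left ?_ (mul_nonneg (hu0 _) (hu0 _))
          nlinarith [sq_nonneg (‖f₂ (p.1 - ε * p.2.1)‖ - ‖f₂ (p.1 - ε * p.2.2)‖),
            sq_nonneg ‖f₂ (p.1 - ε * p.2.1)‖, sq_nonneg ‖f₂ (p.1 - ε * p.2.2)‖]
      _ = _ := by ring
  have hCS := norm_integral_mul_integral_sq_le (k := k) (μ := volume) (ν := volume)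
    hf₃.aestronglyMeasurable h₃ hkm.aestronglyMeasurable hI
  -- the triple integral in difference variables
  set F : ℝ → ℝ → ℂ := fun τ x => f₁ x * conj (f₁ (x + τ)) with hF
  set G : ℝ → ℝ → ℂ := fun τ y => f₂ y * conj (f₂ (y - ε * τ)) with hG
  set a : ℝ → ℝ → ℝ → ℂ := fun τ x y => e x y * conj (e (x + τ) (y - ε * τ)) with ha
  have hIτ : Integrable (fun p : ℝ × (ℝ × ℝ) => F p.1 p.2.1 * (G p.1 p.2.2 * a p.1 p.2.1 p.2.2)) ∧
      ∫ p, I p = ∫ p : ℝ × (ℝ × ℝ), F p.1 p.2.1 * (G p.1 p.2.2 * a p.1 p.2.1 p.2.2) := by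
    have hT := measurePreserving_triple ε
    have hc := hT.integral_comp (measurableEmbedding_triple ε) I
    have hi := (hT.integrable_comp hI.aestronglyMeasurable).2 hI
    have hfun : ∀ p : ℝ × (ℝ × ℝ), I (p.2.2 + ε * p.2.1, (p.2.1, p.1 + p.2.1)) =
        F p.1 p.2.1 * (G p.1 p.2.2 * a p.1 p.2.1 p.2.2) := by
      intro p
      simp only [hIdef, hk, hF, hG, ha, map_mul]
      rw [show p.2.2 + ε * p.2.1 - ε * p.2.1 = p.2.2 by ring,
        show p.2.2 + ε * p.2.1 - ε * (p.1 + p.2.1) = p.2.2 - ε * p.1 by ring,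
        add_comm p.1 p.2.1]
      ring
    refine ⟨hi.congr (Filter.Eventually.of_forall hfun), ?_⟩
    rw [← hc]
    exact integral_congr_ae (Filter.Eventually.of_forall hfun)
  set g : ℝ → ℝ := fun τ => ∫ y, ‖G τ y‖ ^ 2 with hg
  obtain ⟨hv1, hv2⟩ := integrable_mul_comp_sub (v := fun x => ‖f₂ x‖ ^ 2) (by fun_prop) h₂
    (fun _ => sq_nonneg _) hε
  have hGn : ∀ τ y, ‖f₂ y‖ ^ 2 * ‖f₂ (y - ε * τ)‖ ^ 2 = ‖G τ y‖ ^ 2 := by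
    intro τ y
    simp only [hG, norm_mul, RCLike.norm_conj]; ring
  simp only [hGn] at hv1 hv2
  have hgi : Integrable g := hv1.integral_prod_left
  have hgv : ∫ τ, g τ = |ε|⁻¹ * (∫ x, ‖f₂ x‖ ^ 2) ^ 2 := by
    rw [← hv2, Measure.volume_eq_prod, integral_prod _ hv1]
  have hg0 : ∀ τ, 0 ≤ g τ := fun τ => integral_nonneg fun y => sq_nonneg _
  have hGae : ∀ᵐ τ : ℝ, Integrable fun y => ‖G τ y‖ ^ 2 := hv1.prod_right_ae
  have hτ0 : ∀ᵐ τ : ℝ, τ ≠ 0 := by simp [ae_iff]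
  set w := powWeight (2 * R) θ with hw
  have hw0 : ∀ τ, 0 ≤ w τ := powWeight_nonneg _ _
  have hwi : Integrable w := integrable_powWeight (by linarith) hθ
  -- For fixed τ the TT* bound applies with N = B|τ|^(-θ). For |τ| > 2R the points x and x + τ
  -- cannot both lie in [-R, R], so the kernel vanishes and the truncated weight suffices.
  have hJ : ∀ᵐ τ : ℝ, ‖∫ q : ℝ × ℝ, F τ q.1 * (G τ q.2 * a τ q.1 q.2)‖ ≤
      √(M * B * κ) * (√(w τ) * √(g τ)) := by
    filter_upwards [hGae, hτ0, hIτ.1.prod_right_ae] with τ hGτ hτ hint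
    rw [Measure.volume_eq_prod, integral_prod _ hint]
    simp only [integral_const_mul]
    by_cases hτR : |τ| ≤ 2 * R
    · have hwτ : w τ = |τ| ^ (-θ) := by
        rw [hw, powWeight, Set.indicator_of_mem (Set.mem_Icc.2 (abs_le.1 hτR))]
      obtain ⟨F1, F2⟩ := integrable_mul_sq_translate hf₁ h₁ τ
      have hb := norm_bilinear_sq_le (F := F τ) (G := G τ) (a := a τ) (R := R) (θ := θ)
        (N := B * |τ| ^ (-θ))
        (Measurable.mul hf₁ (hconj (by fun_prop))) (Measurable.mul hf₂ (hconj (by fun_prop)))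
        ((hem (by fun_prop) (by fun_prop)).mul (hconj (hem (by fun_prop) (by fun_prop))))
        F1 hGτ hR hθ (by positivity)
        (fun x y => by
          simp only [ha, norm_mul, RCLike.norm_conj]
          exact mul_le_one₀ (he1 _ _) (norm_nonneg _) (he1 _ _))
        (fun x y h => hsupp x y (left_ne_zero_of_mul h))
        (fun y y' hy => hcor τ hτ y y' hy)
      rw [← Real.sqrt_mul (hw0 τ), ← Real.sqrt_mul (by positivity)]
      refine Real.le_sqrt_of_sq_le (hb.trans ?_)
      calc _ ≤ M * (B * |τ| ^ (-θ) * (g τ * κ)) := by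
            refine mul_le_mul_of_nonneg_right F2 ?_
            have := hg0 τ
            positivity
        _ = _ := by rw [hwτ]; ring
    · have hz : ∀ x y, a τ x y = 0 := by
        intro x y
        by_contra h
        have a1 := abs_le.1 (hsupp _ _ (left_ne_zero_of_mul h)).1
        have a2 := abs_le.1 (hsupp _ _ ((map_ne_zero _).1 (right_ne_zero_of_mul h))).1
        exact hτR (abs_le.2 ⟨by linarith [a1.2, a2.1], by linarith [a1.1, a2.2]⟩)
      simp only [hz, mul_zero, integral_zero, norm_zero]
      positivity
  have hsw : Integrable fun τ => √(w τ) ^ 2 := by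
    simpa only [Real.sq_sqrt (hw0 _)] using hwi
  have hsg : Integrable fun τ => √(g τ) ^ 2 := by
    simpa only [Real.sq_sqrt (hg0 _)] using hgi
  have mw : AEStronglyMeasurable (fun τ => √(w τ)) volume :=
    Real.continuous_sqrt.comp_aestronglyMeasurable hwi.aestronglyMeasurable
  have mg : AEStronglyMeasurable (fun τ => √(g τ)) volume :=
    Real.continuous_sqrt.comp_aestronglyMeasurable hgi.aestronglyMeasurable
  have hprod := integrable_mul_of_sq mw mg hsw hsg
  -- Cauchy–Schwarz in τ separates the singular weight from `g`, whose integral is known exactly.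
  have hcs := sq_integral_mul_le mw mg hsw hsg (fun _ => Real.sqrt_nonneg _)
    (fun _ => Real.sqrt_nonneg _)
  simp only [Real.sq_sqrt (hw0 _), Real.sq_sqrt (hg0 _)] at hcs
  have hIle : ‖∫ p, I p‖ ≤ √(M * B * κ) * ∫ τ, √(w τ) * √(g τ) := by
    rw [hIτ.2, Measure.volume_eq_prod, integral_prod _ hIτ.1, ← integral_const_mul]
    exact norm_integral_le_of_norm_le (hprod.const_mul _) hJ
  have hI2 : ‖∫ p, I p‖ ^ 2 ≤ (M * B * κ) * (κ * (|ε|⁻¹ * (∫ x, ‖f₂ x‖ ^ 2) ^ 2)) := by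
    calc _ ≤ (√(M * B * κ) * ∫ τ, √(w τ) * √(g τ)) ^ 2 := by gcongr
      _ = (M * B * κ) * (∫ τ, √(w τ) * √(g τ)) ^ 2 := by
          rw [mul_pow, Real.sq_sqrt (by positivity)]
      _ ≤ _ := by
          rw [← hgv]
          exact mul_le_mul_of_nonneg_left hcs (by positivity)
  rw [hform]
  calc ‖∫ u, f₃ u * ∫ x, k u x‖ ^ 4 = (‖∫ u, f₃ u * ∫ x, k u x‖ ^ 2) ^ 2 := by ring
    _ ≤ ((∫ x, ‖f₃ x‖ ^ 2) * ‖∫ p, I p‖) ^ 2 := by gcongr; exact hCS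
    _ = (∫ x, ‖f₃ x‖ ^ 2) ^ 2 * ‖∫ p, I p‖ ^ 2 := by ring
    _ ≤ (∫ x, ‖f₃ x‖ ^ 2) ^ 2 *
        ((M * B * κ) * (κ * (|ε|⁻¹ * (∫ x, ‖f₂ x‖ ^ 2) ^ 2))) := by gcongr
    _ = _ := by ring

end Trilinear

/-! ### Van der Corput's estimate. -/

section VanDerCorput

/-- A van der Corput estimate: the first derivative of the phase is bounded below and the second
one above. -/
theorem norm_integral_exp_phase_le {a b : ℝ} (hab : a ≤ b) {ψ ψ' ψ'' : ℝ → ℝ}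
    (h1 : ∀ x ∈ Set.Icc a b, HasDerivAt ψ (ψ' x) x)
    (h2 : ∀ x ∈ Set.Icc a b, HasDerivAt ψ' (ψ'' x) x)
    (hc : ContinuousOn ψ'' (Set.Icc a b)) {μ M : ℝ} (hμ : 0 < μ)
    (hl : ∀ x ∈ Set.Icc a b, μ ≤ |ψ' x|) (hu : ∀ x ∈ Set.Icc a b, |ψ'' x| ≤ M) :
    ‖∫ x in Set.Icc a b, Complex.exp (Complex.I * (ψ x : ℂ))‖ ≤
      2 / μ + (b - a) * (M / μ ^ 2) := by
  rw [integral_Icc_eq_integral_Ioc, ← intervalIntegral.integral_of_le hab]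
  have hne : ∀ x ∈ Set.Icc a b, (ψ' x : ℂ) ≠ 0 := fun x hx h => by
    have := hl x hx
    rw [Complex.ofReal_eq_zero.1 h, abs_zero] at this
    linarith
  have hψc : ContinuousOn ψ (Set.Icc a b) := fun x hx => (h1 x hx).continuousAt.continuousWithinAt
  have hψ'c : ContinuousOn ψ' (Set.Icc a b) :=
    fun x hx => (h2 x hx).continuousAt.continuousWithinAt
  set v : ℝ → ℂ := fun x => Complex.exp (Complex.I * (ψ x : ℂ)) with hv
  set v' : ℝ → ℂ := fun x => Complex.exp (Complex.I * (ψ x : ℂ)) * (Complex.I * (ψ' x : ℂ))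
  set u : ℝ → ℂ := fun x => -Complex.I * ((ψ' x : ℂ))⁻¹ with hudef
  set u' : ℝ → ℂ := fun x => -Complex.I * (-(ψ'' x : ℂ) / (ψ' x : ℂ) ^ 2) with hu'def
  have hvd : ∀ x ∈ Set.uIcc a b, HasDerivAt v (v' x) x := by
    intro x hx
    rw [Set.uIcc_of_le hab] at hx
    exact ((h1 x hx).ofReal_comp.const_mul Complex.I).cexp
  have hud : ∀ x ∈ Set.uIcc a b, HasDerivAt u (u' x) x := by
    intro x hx
    rw [Set.uIcc_of_le hab] at hx
    exact ((h2 x hx).ofReal_comp.inv (hne x hx)).const_mul (-Complex.I)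
  have hvi : IntervalIntegrable v' volume a b := by
    refine ContinuousOn.intervalIntegrable ?_
    rw [Set.uIcc_of_le hab]
    fun_prop
  have hui : IntervalIntegrable u' volume a b := by
    refine ContinuousOn.intervalIntegrable ?_
    rw [Set.uIcc_of_le hab]
    refine continuousOn_const.mul (ContinuousOn.div (by fun_prop) (by fun_prop) ?_)
    exact fun x hx => pow_ne_zero 2 (hne x hx)
  -- With u = 1/(iψ') one has v = u v', so one integration by parts suffices; the bound on ψ''
  -- controls u' in place of monotonicity of ψ'.
  have hparts := intervalIntegral.integral_mul_deriv_eq_deriv_mul hud hvd hui hvi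
  have heq : ∫ x in a..b, v x = ∫ x in a..b, u x * v' x := by
    refine intervalIntegral.integral_congr fun x hx => ?_
    rw [Set.uIcc_of_le hab] at hx
    simp only [hv, hudef, v']
    have := hne x hx
    field_simp
    rw [Complex.I_sq]
    ring
  have hvn : ∀ x, ‖v x‖ = 1 := fun x => by
    simp only [hv]
    rw [mul_comm, Complex.norm_exp_ofReal_mul_I]
  have hun : ∀ x ∈ Set.Icc a b, ‖u x‖ ≤ 1 / μ := by
    intro x hx
    simp only [hudef, norm_mul, norm_neg, Complex.norm_I, one_mul, norm_inv, Complex.norm_real,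
      Real.norm_eq_abs]
    rw [one_div]
    exact inv_anti₀ hμ (hl x hx)
  have hu'n : ∀ x ∈ Set.Icc a b, ‖u' x‖ ≤ M / μ ^ 2 := by
    intro x hx
    simp only [hu'def, norm_mul, norm_neg, Complex.norm_I, one_mul, norm_div, norm_pow,
      Complex.norm_real, Real.norm_eq_abs]
    have := hu x hx
    have := hl x hx
    have : 0 ≤ M := (abs_nonneg _).trans (hu x hx)
    gcongr
  have hint : ‖∫ x in a..b, u' x * v x‖ ≤ M / μ ^ 2 * |b - a| := by
    refine intervalIntegral.norm_integral_le_of_norm_le_const fun x hx => ?_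
    rw [Set.uIoc_of_le hab] at hx
    rw [norm_mul, hvn, mul_one]
    exact hu'n x ⟨hx.1.le, hx.2⟩
  rw [abs_of_nonneg (by linarith)] at hint
  rw [heq, hparts]
  have ha := hun a (Set.left_mem_Icc.2 hab)
  have hb := hun b (Set.right_mem_Icc.2 hab)
  calc _ ≤ ‖u b * v b‖ + ‖u a * v a‖ + ‖∫ x in a..b, u' x * v x‖ :=
        (norm_sub_le _ _).trans (by gcongr; exact norm_sub_le _ _)
    _ ≤ 1 / μ + 1 / μ + M / μ ^ 2 * (b - a) := by
        rw [norm_mul (u b), norm_mul (u a), hvn, hvn, mul_one, mul_one]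
        gcongr
    _ = _ := by ring

end VanDerCorput

/-! ### Double differences over a parallelogram. -/

section DoubleDifference

/-- The double difference of `h` over the parallelogram with vertices `(x, y)`, `(x, y')`,
`(x + τ, y - ε τ)`, `(x + τ, y' - ε τ)`. -/
def doubleDiff (h : ℝ × ℝ → ℝ) (ε τ y y' x : ℝ) : ℝ :=
  (h (x, y) - h (x + τ, y - ε * τ)) - (h (x, y') - h (x + τ, y' - ε * τ))

/-- The mean value theorem for double differences. -/
theorem exists_doubleDiff_eq {K : Set (ℝ × ℝ)} (hK : Convex ℝ K) {h hvy : ℝ × ℝ → ℝ}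
    {h' : ℝ × ℝ → ℝ × ℝ →L[ℝ] ℝ} {ε : ℝ} (H1 : ∀ p ∈ K, HasFDerivAt h (h' p) p)
    {hv : ℝ × ℝ → ℝ} (Hv : ∀ p ∈ K, h' p (1, -ε) = hv p)
    (H2 : ∀ p ∈ K, HasDerivAt (fun y => hv (p.1, y)) (hvy p) p.2) {x τ y y' : ℝ}
    (k1 : (x, y) ∈ K) (k2 : (x + τ, y - ε * τ) ∈ K) (k3 : (x, y') ∈ K)
    (k4 : (x + τ, y' - ε * τ) ∈ K) :
    ∃ p ∈ K, doubleDiff h ε τ y y' x = τ * (y' - y) * hvy p := by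
  have m1 : ∀ s ∈ Set.Icc (0 : ℝ) 1, (x + s * τ, y - ε * (s * τ)) ∈ K := by
    intro s hs
    convert hK.add_smul_sub_mem k1 k2 hs using 1
    ext
    · simp
    · simp; ring
  have m2 : ∀ s ∈ Set.Icc (0 : ℝ) 1, (x + s * τ, y' - ε * (s * τ)) ∈ K := by
    intro s hs
    convert hK.add_smul_sub_mem k3 k4 hs using 1
    ext
    · simp
    · simp; ring
  have d : ∀ z : ℝ, ∀ s : ℝ, (x + s * τ, z - ε * (s * τ)) ∈ K →
      HasDerivAt (fun s : ℝ => h (x + s * τ, z - ε * (s * τ)))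
        (τ * hv (x + s * τ, z - ε * (s * τ))) s := by
    intro z s hs
    have c : HasDerivAt (fun s : ℝ => (x + s * τ, z - ε * (s * τ))) (τ, -(ε * τ)) s := by
      refine HasDerivAt.prodMk ?_ ?_
      · simpa using ((hasDerivAt_id s).mul_const τ).const_add x
      · simpa using (((hasDerivAt_id s).mul_const τ).const_mul ε).const_sub z
    refine ((H1 _ hs).comp_hasDerivAt s c).congr_deriv ?_
    rw [← Hv _ hs, show ((τ, -(ε * τ)) : ℝ × ℝ) = τ • ((1, -ε) : ℝ × ℝ) by ext <;> simp; ring,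
      map_smul, smul_eq_mul]
  -- First mean value: move both left vertices simultaneously along τ(1, -ε). The points reached
  -- stay in `K` by convexity.
  obtain ⟨s, hs, es⟩ := exists_hasDerivAt_eq_slope
    (fun s => h (x + s * τ, y - ε * (s * τ)) - h (x + s * τ, y' - ε * (s * τ))) _ zero_lt_one
    (fun s hs => ((d y s (m1 s hs)).sub (d y' s (m2 s hs))).continuousAt.continuousWithinAt)
    (fun s hs => (d y s (m1 s (Set.Ioo_subset_Icc_self hs))).sub
      (d y' s (m2 s (Set.Ioo_subset_Icc_self hs))))
  have hs' := Set.Ioo_subset_Icc_self hs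
  have m3 : ∀ r ∈ Set.Icc (0 : ℝ) 1, (x + s * τ, y - ε * (s * τ) + r * (y' - y)) ∈ K := by
    intro r hr
    convert hK.add_smul_sub_mem (m1 s hs') (m2 s hs') hr using 1
    ext <;> simp
  have d2 : ∀ r ∈ Set.Icc (0 : ℝ) 1,
      HasDerivAt (fun r => hv (x + s * τ, y - ε * (s * τ) + r * (y' - y)))
        (hvy (x + s * τ, y - ε * (s * τ) + r * (y' - y)) * (y' - y)) r := by
    intro r hr
    have c : HasDerivAt (fun r : ℝ => y - ε * (s * τ) + r * (y' - y)) (y' - y) r := by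
      simpa using ((hasDerivAt_id r).mul_const (y' - y)).const_add (y - ε * (s * τ))
    exact (H2 _ (m3 r hr)).comp r c
  -- Second mean value: along the vertical segment joining the two points at the same `s`.
  obtain ⟨r, hr, er⟩ := exists_hasDerivAt_eq_slope
    (fun r => hv (x + s * τ, y - ε * (s * τ) + r * (y' - y))) _ zero_lt_one
    (fun r hr => (d2 r hr).continuousAt.continuousWithinAt)
    (fun r hr => d2 r (Set.Ioo_subset_Icc_self hr))
  refine ⟨_, m3 r (Set.Ioo_subset_Icc_self hr), ?_⟩
  simp only [zero_mul, mul_zero, add_zero, sub_zero, one_mul, div_one] at es er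
  rw [show y - ε * (s * τ) + (y' - y) = y' - ε * (s * τ) by ring] at er
  unfold doubleDiff
  linear_combination es - τ * er

end DoubleDifference

/-! ### Correlations of the oscillatory kernel. -/

section Correlation

/-- The kernel `e^{iλQ}` restricted to `K`. -/
noncomputable def oscKernel (K : Set (ℝ × ℝ)) (Q : ℝ × ℝ → ℝ) (lam x y : ℝ) : ℂ :=
  K.indicator (fun p => Complex.exp (Complex.I * ((lam * Q p : ℝ) : ℂ))) (x, y)

theorem norm_oscKernel_le (K : Set (ℝ × ℝ)) (Q : ℝ × ℝ → ℝ) (lam x y : ℝ) :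
    ‖oscKernel K Q lam x y‖ ≤ 1 := by
  refine (norm_indicator_le_norm_self _ _).trans (le_of_eq ?_)
  rw [mul_comm, Complex.norm_exp_ofReal_mul_I]

theorem mem_of_oscKernel_ne_zero {K : Set (ℝ × ℝ)} {Q : ℝ × ℝ → ℝ} {lam x y : ℝ}
    (h : oscKernel K Q lam x y ≠ 0) : (x, y) ∈ K :=
  Set.mem_of_indicator_ne_zero h

theorem measurable_oscKernel {K : Set (ℝ × ℝ)} (hK : MeasurableSet K) {Q : ℝ × ℝ → ℝ}
    (hQ : ContinuousOn Q K) (lam : ℝ) : Measurable (Function.uncurry (oscKernel K Q lam)) := by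
  classical
  have h : Measurable (K.piecewise
      (fun p => Complex.exp (Complex.I * ((lam * Q p : ℝ) : ℂ))) 0) :=
    ContinuousOn.measurable_piecewise (by fun_prop) continuousOn_const hK
  rwa [Set.piecewise_eq_indicator] at h

/-- The four points of the parallelogram of `doubleDiff` lie in `K`. -/
def parallelogramSet (K : Set (ℝ × ℝ)) (ε τ y y' : ℝ) : Set ℝ :=
  {x | ((x, y) ∈ K ∧ (x + τ, y - ε * τ) ∈ K) ∧ ((x, y') ∈ K ∧ (x + τ, y' - ε * τ) ∈ K)}

theorem oscKernel_correlation (K : Set (ℝ × ℝ)) (Q : ℝ × ℝ → ℝ) (lam ε τ y y' x : ℝ) :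
    (oscKernel K Q lam x y * conj (oscKernel K Q lam (x + τ) (y - ε * τ))) *
        conj (oscKernel K Q lam x y' * conj (oscKernel K Q lam (x + τ) (y' - ε * τ))) =
      (parallelogramSet K ε τ y y').indicator
        (fun x => Complex.exp (Complex.I * ((lam * doubleDiff Q ε τ y y' x : ℝ) : ℂ))) x := by
  by_cases h1 : (x, y) ∈ K
  swap
  · rw [Set.indicator_of_notMem (fun h => h1 h.1.1)]; simp [oscKernel, h1]
  by_cases h2 : (x + τ, y - ε * τ) ∈ K
  swap
  · rw [Set.indicator_of_notMem (fun h => h2 h.1.2)]; simp [oscKernel, h2]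
  by_cases h3 : (x, y') ∈ K
  swap
  · rw [Set.indicator_of_notMem (fun h => h3 h.2.1)]; simp [oscKernel, h3]
  by_cases h4 : (x + τ, y' - ε * τ) ∈ K
  swap
  · rw [Set.indicator_of_notMem (fun h => h4 h.2.2)]; simp [oscKernel, h4]
  rw [Set.indicator_of_mem (show x ∈ parallelogramSet K ε τ y y' from ⟨⟨h1, h2⟩, ⟨h3, h4⟩⟩)]
  simp only [oscKernel, Set.indicator_of_mem h1, Set.indicator_of_mem h2, Set.indicator_of_mem h3,
    Set.indicator_of_mem h4]
  simp only [map_mul, ← Complex.exp_conj, Complex.conj_I, Complex.conj_ofReal, neg_mul, map_neg,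
    neg_neg, map_add, ← Complex.exp_add, doubleDiff]
  congr 1
  push_cast
  ring

theorem isCompact_parallelogramSet {K : Set (ℝ × ℝ)} (hK : IsCompact K) (ε τ y y' : ℝ) :
    IsCompact (parallelogramSet K ε τ y y') := by
  have hcl := hK.isClosed
  refine IsCompact.of_isClosed_subset (hK.image continuous_fst) ?_ fun x hx => ⟨_, hx.1.1, rfl⟩
  refine ((hcl.preimage (f := fun x : ℝ => (x, y)) (by fun_prop)).inter
    (hcl.preimage (f := fun x : ℝ => (x + τ, y - ε * τ)) (by fun_prop))).inter
    ((hcl.preimage (f := fun x : ℝ => (x, y')) (by fun_prop)).inter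
    (hcl.preimage (f := fun x : ℝ => (x + τ, y' - ε * τ)) (by fun_prop)))

/-- Being an intersection of translated horizontal sections of `K`, the domain of integration is
convex. With compactness this makes it a single closed interval, as van der Corput's estimate
requires. -/
theorem convex_parallelogramSet {K : Set (ℝ × ℝ)} (hK : Convex ℝ K) (ε τ y y' : ℝ) :
    Convex ℝ (parallelogramSet K ε τ y y') := by
  have key : ∀ (c z : ℝ) {x x' a b : ℝ}, (x + c, z) ∈ K → (x' + c, z) ∈ K → 0 ≤ a → 0 ≤ b →
      a + b = 1 → (a * x + b * x' + c, z) ∈ K := by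
    intro c z x x' a b h h' ha hb hab
    convert hK h h' ha hb hab using 1
    ext
    · simp only [Prod.smul_mk, smul_eq_mul, Prod.mk_add_mk]
      linear_combination (-c) * hab
    · simp only [Prod.smul_mk, smul_eq_mul, Prod.mk_add_mk]
      linear_combination (-z) * hab
  intro x hx x' hx' a b ha hb hab
  have k0 := fun z => key 0 z (x := x) (x' := x') (a := a) (b := b)
  simp only [add_zero] at k0
  exact ⟨⟨k0 _ hx.1.1 hx'.1.1 ha hb hab, key τ _ hx.1.2 hx'.1.2 ha hb hab⟩,
    ⟨k0 _ hx.2.1 hx'.2.1 ha hb hab, key τ _ hx.2.2 hx'.2.2 ha hb hab⟩⟩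

theorem hasDerivAt_doubleDiff {K : Set (ℝ × ℝ)} {h h' : ℝ × ℝ → ℝ}
    (H : ∀ p ∈ K, HasDerivAt (fun x => h (x, p.2)) (h' p) p.1) {ε τ y y' x : ℝ}
    (hx : x ∈ parallelogramSet K ε τ y y') :
    HasDerivAt (doubleDiff h ε τ y y') (doubleDiff h' ε τ y y' x) x := by
  obtain ⟨⟨k1, k2⟩, k3, k4⟩ := hx
  exact ((H _ k1).sub ((H _ k2).comp_add_const x τ)).sub
    ((H _ k3).sub ((H _ k4).comp_add_const x τ))

/-- For s ≤ 1 the trivial bound suffices, as 1 ≤ s^(-θ); for s ≥ 1 the decaying one does, as s⁻¹ ≤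
s^(-θ). -/
theorem min_le_rpow_neg {X a D s θ : ℝ} (ha : 0 ≤ a) (hD : 0 ≤ D) (hs : 0 < s) (hθ0 : 0 ≤ θ)
    (hθ1 : θ ≤ 1) (h1 : X ≤ a) (h2 : X ≤ D / s) : X ≤ (a + D) * s ^ (-θ) := by
  rcases le_total s 1 with h | h
  · have : 1 ≤ s ^ (-θ) := Real.one_le_rpow_of_pos_of_le_one_of_nonpos hs h (by linarith)
    nlinarith
  · have h3 : s⁻¹ ≤ s ^ (-θ) := by
      rw [← Real.rpow_neg_one]
      exact Real.rpow_le_rpow_of_exponent_le h (by linarith)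
    have h4 : 0 ≤ s ^ (-θ) := by positivity
    rw [div_eq_mul_inv] at h2
    nlinarith

/-- Decay of the fourfold correlations of `oscKernel`. -/
theorem norm_correlation_oscKernel_le {K : Set (ℝ × ℝ)} (hKc : IsCompact K) (hK : Convex ℝ K)
    {Q T W : ℝ × ℝ → ℝ} {A c M R lam ε θ : ℝ} (hA : 0 < A) (hc : 0 < c) (hM : 0 ≤ M) (hR : 0 ≤ R)
    (hlam : 0 < lam) (hθ0 : 0 ≤ θ) (hθ1 : θ ≤ 1) (hKR : ∀ p ∈ K, |p.1| ≤ R)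
    (hQ : ∀ p ∈ K, HasDerivAt (fun x => Q (x, p.2)) (A * T p) p.1)
    (hT : ∀ p ∈ K, HasDerivAt (fun x => T (x, p.2)) (A * W p) p.1)
    (hW : ContinuousOn W K)
    (hlow : ∀ τ y y' x, x ∈ parallelogramSet K ε τ y y' →
      c * (|τ| * |y - y'|) ≤ |doubleDiff T ε τ y y' x|)
    (hup : ∀ τ y y' x, x ∈ parallelogramSet K ε τ y y' →
      |doubleDiff W ε τ y y' x| ≤ M * (|τ| * |y - y'|))
    {τ : ℝ} (hτ : τ ≠ 0) {y y' : ℝ} (hy : y ≠ y') :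
    ‖∫ x, (oscKernel K Q lam x y * conj (oscKernel K Q lam (x + τ) (y - ε * τ))) *
        conj (oscKernel K Q lam x y' * conj (oscKernel K Q lam (x + τ) (y' - ε * τ)))‖ ≤
      ((2 * R + (2 / (A * c) + 2 * R * (M / c ^ 2))) * lam ^ (-θ)) *
        |τ| ^ (-θ) * |y - y'| ^ (-θ) := by
  simp only [oscKernel_correlation]
  set S := parallelogramSet K ε τ y y' with hS
  have hSc : IsCompact S := isCompact_parallelogramSet hKc _ _ _ _
  have hSx : Convex ℝ S := convex_parallelogramSet hK _ _ _ _
  rw [integral_indicator hSc.measurableSet]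
  have hδ : 0 < |τ| * |y - y'| := mul_pos (abs_pos.2 hτ) (abs_pos.2 (sub_ne_zero.2 hy))
  set δ := |τ| * |y - y'| with hδdef
  have hrhs : ((2 * R + (2 / (A * c) + 2 * R * (M / c ^ 2))) * lam ^ (-θ)) *
        |τ| ^ (-θ) * |y - y'| ^ (-θ) =
      (2 * R + (2 / (A * c) + 2 * R * (M / c ^ 2))) * (lam * δ) ^ (-θ) := by
    rw [Real.mul_rpow hlam.le hδ.le, hδdef, Real.mul_rpow (abs_nonneg _) (abs_nonneg _)]
    ring
  rw [hrhs]
  rcases S.eq_empty_or_nonempty with hemp | hne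
  · rw [hemp, Measure.restrict_empty, integral_zero_measure, norm_zero]
    positivity
  have hIcc : S = Set.Icc (sInf S) (sSup S) :=
    eq_Icc_of_connected_compact ⟨hne, hSx.isPreconnected⟩ hSc
  have hab : sInf S ≤ sSup S := by
    by_contra h
    rw [Set.Icc_eq_empty h] at hIcc
    exact hne.ne_empty hIcc
  set a := sInf S
  set b := sSup S
  have hSR : ∀ x ∈ S, |x| ≤ R := fun x hx => hKR _ hx.1.1
  have hba : b - a ≤ 2 * R := by
    have h1 := abs_le.1 (hSR a (hIcc ▸ Set.left_mem_Icc.2 hab))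
    have h2 := abs_le.1 (hSR b (hIcc ▸ Set.right_mem_Icc.2 hab))
    linarith [h1.1, h2.2]
  rw [hIcc]
  refine min_le_rpow_neg (by positivity) (by positivity) (mul_pos hlam hδ) hθ0 hθ1 ?_ ?_
  · have := norm_setIntegral_le_of_norm_le_const (μ := volume) (s := Set.Icc a b) (C := 1)
      (f := fun x => Complex.exp (Complex.I * ((lam * doubleDiff Q ε τ y y' x : ℝ) : ℂ)))
      (by simp) (fun x _ => by rw [mul_comm, Complex.norm_exp_ofReal_mul_I])
    refine this.trans ?_
    rw [Real.volume_real_Icc_of_le hab, one_mul]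
    exact hba
  · have hmem : ∀ x ∈ Set.Icc a b, x ∈ S := fun x hx => by rw [hIcc]; exact hx
    have d1 : ∀ x ∈ Set.Icc a b, HasDerivAt (fun x => lam * doubleDiff Q ε τ y y' x)
        (lam * (A * doubleDiff T ε τ y y' x)) x := by
      intro x hx
      have := (hasDerivAt_doubleDiff hQ (hmem x hx)).const_mul lam
      exact this.congr_deriv (by simp only [doubleDiff]; ring)
    have d2 : ∀ x ∈ Set.Icc a b, HasDerivAt (fun x => lam * (A * doubleDiff T ε τ y y' x))
        (lam * (A * (A * doubleDiff W ε τ y y' x))) x := by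
      intro x hx
      have := ((hasDerivAt_doubleDiff hT (hmem x hx)).const_mul A).const_mul lam
      exact this.congr_deriv (by simp only [doubleDiff]; ring)
    have hcont : ContinuousOn (fun x => lam * (A * (A * doubleDiff W ε τ y y' x)))
        (Set.Icc a b) := by
      have w1 : ContinuousOn (fun x => W (x, y)) (Set.Icc a b) :=
        hW.comp (by fun_prop) fun x hx => (hmem x hx).1.1
      have w2 : ContinuousOn (fun x => W (x + τ, y - ε * τ)) (Set.Icc a b) :=
        hW.comp (by fun_prop) fun x hx => (hmem x hx).1.2
      have w3 : ContinuousOn (fun x => W (x, y')) (Set.Icc a b) :=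
        hW.comp (by fun_prop) fun x hx => (hmem x hx).2.1
      have w4 : ContinuousOn (fun x => W (x + τ, y' - ε * τ)) (Set.Icc a b) :=
        hW.comp (by fun_prop) fun x hx => (hmem x hx).2.2
      exact continuousOn_const.mul (continuousOn_const.mul
        (continuousOn_const.mul ((w1.sub w2).sub (w3.sub w4))))
    -- Both the lower bound for the first derivative and the upper bound for the second are linear
    -- in λδ, so both terms of the estimate are multiples of (λδ)⁻¹.
    refine (norm_integral_exp_phase_le hab d1 d2 hcont
      (μ := lam * (A * (c * δ))) (M := lam * (A * (A * (M * δ)))) (by positivity) ?_ ?_).trans ?_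
    · intro x hx
      rw [abs_mul, abs_mul, abs_of_pos hlam, abs_of_pos hA]
      gcongr
      exact hlow _ _ _ _ (hmem x hx)
    · intro x hx
      rw [abs_mul, abs_mul, abs_mul, abs_of_pos hlam, abs_of_pos hA]
      gcongr
      exact hup _ _ _ _ (hmem x hx)
    · calc _ ≤ 2 / (lam * (A * (c * δ))) +
            2 * R * (lam * (A * (A * (M * δ))) / (lam * (A * (c * δ))) ^ 2) := by gcongr
        _ = _ := by field_simp

end Correlation

/-! ### The critical point as an implicit function. -/

section Implicit

variable {β A B : ℝ}

/-- The derivative in `t` of the phase with coefficients `A`, `B`. -/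
noncomputable def phaseDeriv (β A B : ℝ) (p : ℝ × ℝ) (t : ℝ) : ℝ :=
  A * p.1 + B * p.2 * (2 * t) + β * t ^ (-β - 1)

/-- Minus the second derivative in `t` of the phase. -/
noncomputable def phaseCurv (β B y t : ℝ) : ℝ :=
  β * (β + 1) * t ^ (-β - 2) - 2 * B * y

theorem one_le_rpow_of_mem {t : ℝ} (ht : t ∈ Set.Ioo (0 : ℝ) 1) {s : ℝ} (hs : s ≤ 0) :
    1 ≤ t ^ s :=
  Real.one_le_rpow_of_pos_of_le_one_of_nonpos ht.1 ht.2.le hs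

/-- On (0,1) the singular term contributes at least β(β+1) ≥ 2, while B ≤ 1/2 limits the quadratic
term to |y|. Hence the phase is strictly concave there when |y| < 2. -/
theorem phaseCurv_gt (hβ : 1 < β) (hB0 : 0 < B) (hB : B ≤ 1 / 2) {y t : ℝ}
    (ht : t ∈ Set.Ioo (0 : ℝ) 1) : 2 - |y| ≤ phaseCurv β B y t := by
  have h1 := one_le_rpow_of_mem ht (s := -β - 2) (by linarith)
  have h2 : 2 * B * y ≤ |y| := by nlinarith [le_abs_self y, abs_nonneg y]
  have h3 : 2 ≤ β * (β + 1) := by nlinarith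
  unfold phaseCurv
  nlinarith

theorem hasDerivAt_phaseDeriv (p : ℝ × ℝ) {t : ℝ} (ht : 0 < t) :
    HasDerivAt (phaseDeriv β A B p) (-phaseCurv β B p.2 t) t := by
  have h1 := (Real.hasDerivAt_rpow_const (p := -β - 1) (Or.inl ht.ne')).const_mul β
  have h2 := ((hasDerivAt_id t).const_mul 2).const_mul (B * p.2)
  have h3 := (h2.const_add (A * p.1)).add h1
  refine h3.congr_deriv ?_
  rw [phaseCurv, show -β - 1 - 1 = -β - 2 by ring]
  ring

theorem strictAntiOn_phaseDeriv (hβ : 1 < β) (hB0 : 0 < B) (hB : B ≤ 1 / 2) {p : ℝ × ℝ}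
    (hp : |p.2| < 2) : StrictAntiOn (phaseDeriv β A B p) (Set.Ioo 0 1) := by
  refine strictAntiOn_of_deriv_neg (convex_Ioo _ _)
    (fun t ht => (hasDerivAt_phaseDeriv p ht.1).continuousAt.continuousWithinAt) fun t ht => ?_
  rw [interior_Ioo] at ht
  rw [(hasDerivAt_phaseDeriv p ht.1).deriv]
  linarith [phaseCurv_gt hβ hB0 hB ht (y := p.2)]

/-- `T` is the implicit function that solves `phaseDeriv β A B p (T p) = 0`. -/
def IsImplicitSol (β A B : ℝ) (T : ℝ × ℝ → ℝ) : Prop :=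
  ∀ p : ℝ × ℝ, ∀ t ∈ Set.Ioo (0 : ℝ) 1, |p.2| < 2 → phaseDeriv β A B p t = 0 → T p = t

/-- The critical equation is linear in ξ, so (t, η) ↦ (ξ, η) is an explicit map `f`, with invertible
derivative because Z ≠ 0. The inverse function theorem gives a local inverse, and uniqueness of the
solution identifies its first component with `T` near `p`. The open ranges (0,1) and |η| < 2 leave
room for this at boundary points of the region used later. -/
theorem IsImplicitSol.hasFDerivAt {T : ℝ × ℝ → ℝ} (hT : IsImplicitSol β A B T) (hβ : 1 < β)
    (hA : 0 < A) (hB0 : 0 < B) (hB : B ≤ 1 / 2) {p : ℝ × ℝ} {t : ℝ} (ht : t ∈ Set.Ioo (0 : ℝ) 1)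
    (hp : |p.2| < 2) (h : phaseDeriv β A B p t = 0) :
    HasFDerivAt T ((phaseCurv β B p.2 t)⁻¹ •
      (A • ContinuousLinearMap.fst ℝ ℝ ℝ + (2 * B * t) • ContinuousLinearMap.snd ℝ ℝ ℝ)) p := by
  set Z := phaseCurv β B p.2 t with hZ
  have hZ0 : Z ≠ 0 := by linarith [phaseCurv_gt hβ hB0 hB ht (y := p.2)] |> fun h : 0 < Z => h.ne'
  set f : ℝ × ℝ → ℝ × ℝ := fun q => (-(A⁻¹ * (B * q.2 * (2 * q.1) + β * q.1 ^ (-β - 1))), q.2)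
    with hf
  set L : (ℝ × ℝ) ≃L[ℝ] (ℝ × ℝ) := ContinuousLinearEquiv.equivOfInverse
    (((Z / A) • ContinuousLinearMap.fst ℝ ℝ ℝ - (2 * B * t / A) •
      ContinuousLinearMap.snd ℝ ℝ ℝ).prod (ContinuousLinearMap.snd ℝ ℝ ℝ))
    ((Z⁻¹ • (A • ContinuousLinearMap.fst ℝ ℝ ℝ + (2 * B * t) •
      ContinuousLinearMap.snd ℝ ℝ ℝ)).prod (ContinuousLinearMap.snd ℝ ℝ ℝ))
    (fun q => by ext <;> simp; field_simp; ring) (fun q => by ext <;> simp; field_simp; ring)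
    with hL
  have hstrict : HasStrictFDerivAt f (L : (ℝ × ℝ) →L[ℝ] (ℝ × ℝ)) (t, p.2) := by
    have e1 : HasStrictFDerivAt (fun q : ℝ × ℝ => q.1) (ContinuousLinearMap.fst ℝ ℝ ℝ) (t, p.2) :=
      hasStrictFDerivAt_fst
    have e2 : HasStrictFDerivAt (fun q : ℝ × ℝ => q.2) (ContinuousLinearMap.snd ℝ ℝ ℝ) (t, p.2) :=
      hasStrictFDerivAt_snd
    have e3 := (Real.hasStrictDerivAt_rpow_const (p := -β - 1)
      (Or.inl ht.1.ne')).comp_hasStrictFDerivAt (f := fun q : ℝ × ℝ => q.1) (t, p.2) e1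
    have e4 := ((((e2.const_mul B).mul (e1.const_mul 2)).add (e3.const_mul β)).const_mul A⁻¹).neg
    refine (e4.prodMk e2).congr_fderiv ?_
    refine ContinuousLinearMap.ext fun q => ?_
    have hZ' : Z = β * (β + 1) * t ^ (-β - 1 - 1) - 2 * B * p.2 := by
      rw [hZ, phaseCurv, show -β - 1 - 1 = -β - 2 by ring]
    ext
    · simp [hL, ContinuousLinearEquiv.equivOfInverse, hZ']
      field_simp
      ring
    · simp [hL, ContinuousLinearEquiv.equivOfInverse]
  have hfp : f (t, p.2) = p := by
    ext
    · simp only [hf]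
      unfold phaseDeriv at h
      field_simp
      linarith
    · rfl
  have hinv := hstrict.to_localInverse
  have hev := hstrict.eventually_right_inverse
  set g := hstrict.localInverse f L (t, p.2) with hg
  have hgp : g (f (t, p.2)) = (t, p.2) := hstrict.localInverse_apply_image
  rw [hfp] at hinv hev hgp
  have hcont : Filter.Tendsto g (nhds p) (nhds (t, p.2)) := by
    have := hinv.hasFDerivAt.continuousAt
    rwa [ContinuousAt, hgp] at this
  have hU : Set.Ioo (0 : ℝ) 1 ×ˢ Set.Ioo (-2 : ℝ) 2 ∈ nhds (t, p.2) :=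
    prod_mem_nhds (Ioo_mem_nhds ht.1 ht.2) (Ioo_mem_nhds (abs_lt.1 hp).1 (abs_lt.1 hp).2)
  have hTg : ∀ᶠ q in nhds p, T q = (g q).1 := by
    filter_upwards [hev, hcont hU] with q hq hqU
    have h1 : -(A⁻¹ * (B * (g q).2 * (2 * (g q).1) + β * (g q).1 ^ (-β - 1))) = q.1 :=
      congrArg Prod.fst hq
    have h2 : (f (g q)).2 = q.2 := by rw [hq]
    change (g q).2 = q.2 at h2
    refine hT q _ hqU.1 (by rw [← h2]; exact abs_lt.2 hqU.2) ?_
    rw [phaseDeriv, ← h1, h2]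
    field_simp
    ring
  have hfst := hinv.hasFDerivAt.fst
  refine (hfst.congr_of_eventuallyEq hTg).congr_fderiv ?_
  refine ContinuousLinearMap.ext fun q => ?_
  have hs : (L.symm q).1 = Z⁻¹ * (A * q.1 + 2 * B * t * q.2) := rfl
  change (L.symm q).1 = _
  rw [hs]
  simp
  ring

end Implicit

/-! ### The region of critical frequencies and the inverse curvature. -/

section Region

variable {β A B : ℝ} {T : ℝ × ℝ → ℝ}

/-- The frequencies with `|η| ≤ 1` at which the phase has a critical point in `[1/16, 9/16]`. -/
def critRegion (β A B : ℝ) : Set (ℝ × ℝ) :=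
  {p | |p.2| ≤ 1 ∧ ∃ t ∈ Set.Icc (1 / 16 : ℝ) (9 / 16), phaseDeriv β A B p t = 0}

theorem Icc_subset_Ioo_zero_one : Set.Icc (1 / 16 : ℝ) (9 / 16) ⊆ Set.Ioo 0 1 :=
  fun t ht => ⟨by linarith [ht.1], by linarith [ht.2]⟩

/-- The derivative of the phase decreases in t, so it has a zero in the interval exactly when it
changes sign between the endpoints. -/
theorem critRegion_eq (hβ : 1 < β) (hB0 : 0 < B) (hB : B ≤ 1 / 2) :
    critRegion β A B =
      {p | |p.2| ≤ 1 ∧ phaseDeriv β A B p (9 / 16) ≤ 0 ∧ 0 ≤ phaseDeriv β A B p (1 / 16)} := by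
  ext p
  simp only [critRegion, Set.mem_ofPred_eq]
  refine and_congr_right fun hp => ?_
  have hanti := (strictAntiOn_phaseDeriv (A := A) hβ hB0 hB (p := p) (by linarith)).antitoneOn
  have h1 : (1 / 16 : ℝ) ∈ Set.Icc (1 / 16 : ℝ) (9 / 16) := by constructor <;> norm_num
  have h9 : (9 / 16 : ℝ) ∈ Set.Icc (1 / 16 : ℝ) (9 / 16) := by constructor <;> norm_num
  constructor
  · rintro ⟨t, ht, h0⟩
    have ht' := Icc_subset_Ioo_zero_one ht
    rw [← h0]
    exact ⟨hanti ht' (Icc_subset_Ioo_zero_one h9) ht.2,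
      hanti (Icc_subset_Ioo_zero_one h1) ht' ht.1⟩
  · rintro ⟨h2, h3⟩
    have hc : ContinuousOn (phaseDeriv β A B p) (Set.Icc (1 / 16) (9 / 16)) := fun t ht =>
      (hasDerivAt_phaseDeriv p (Icc_subset_Ioo_zero_one ht).1).continuousAt.continuousWithinAt
    obtain ⟨t, ht, h⟩ := intermediate_value_Icc' (by norm_num) hc ⟨h2, h3⟩
    exact ⟨t, ht, h⟩

/-- At a fixed t the derivative of the phase is affine in the frequencies, so the endpoint
conditions cut out half-planes. -/
theorem convex_critRegion (hβ : 1 < β) (hB0 : 0 < B) (hB : B ≤ 1 / 2) :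
    Convex ℝ (critRegion β A B) := by
  rw [critRegion_eq hβ hB0 hB]
  rintro p ⟨p1, p2, p3⟩ q ⟨q1, q2, q3⟩ a b ha hb hab
  have p1 := abs_le.1 p1
  have q1 := abs_le.1 q1
  have key : ∀ t, phaseDeriv β A B (a • p + b • q) t =
      a * phaseDeriv β A B p t + b * phaseDeriv β A B q t := by
    intro t
    simp only [phaseDeriv, Prod.fst_add, Prod.snd_add, Prod.smul_fst, Prod.smul_snd, smul_eq_mul]
    linear_combination (-(β * t ^ (-β - 1))) * hab
  refine ⟨?_, ?_, ?_⟩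
  · simp only [Prod.snd_add, Prod.smul_snd, smul_eq_mul]
    exact abs_le.2 ⟨by nlinarith, by nlinarith⟩
  · rw [key]; nlinarith
  · rw [key]; nlinarith [mul_nonneg ha p3, mul_nonneg hb q3]

theorem exists_critRegion_bound (hβ : 1 < β) (hA : 0 < A) (hB0 : 0 < B) (hB : B ≤ 1 / 2) :
    ∃ R : ℝ, 1 ≤ R ∧ ∀ p ∈ critRegion β A B, |p.1| ≤ R ∧ |p.2| ≤ R := by
  refine ⟨(1 + β * (1 / 16) ^ (-β - 1)) / A + 1, ?_, ?_⟩
  · have : 0 ≤ (1 + β * (1 / 16) ^ (-β - 1)) / A := by positivity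
    linarith
  · rintro p ⟨hp, t, ht, h⟩
    have ht' := Icc_subset_Ioo_zero_one ht
    have h1 : t ^ (-β - 1) ≤ (1 / 16) ^ (-β - 1) :=
      Real.rpow_le_rpow_of_nonpos (by norm_num) ht.1 (by linarith)
    have h0 : 0 < t ^ (-β - 1) := Real.rpow_pos_of_pos ht'.1 _
    have h2 : |B * p.2 * (2 * t)| ≤ 1 := by
      rw [abs_mul, abs_mul, abs_of_pos hB0, abs_of_pos (by linarith [ht'.1] : 0 < 2 * t)]
      have : B * |p.2| ≤ 1 / 2 := by nlinarith [abs_nonneg p.2]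
      have h3 : 0 ≤ B * |p.2| := by positivity
      nlinarith [ht'.1, ht'.2]
    have h3 : |A * p.1| ≤ 1 + β * (1 / 16) ^ (-β - 1) := by
      unfold phaseDeriv at h
      have := abs_le.1 h2
      have h4 : 0 < β * t ^ (-β - 1) := by positivity
      have h5 : β * t ^ (-β - 1) ≤ β * (1 / 16) ^ (-β - 1) := by gcongr
      exact abs_le.2 ⟨by linarith, by linarith⟩
    rw [abs_mul, abs_of_pos hA] at h3
    have h4 : |p.1| ≤ (1 + β * (1 / 16) ^ (-β - 1)) / A := by
      rw [le_div_iff₀ hA]; linarith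
    have : 0 ≤ (1 + β * (1 / 16) ^ (-β - 1)) / A := (abs_nonneg _).trans h4
    exact ⟨by linarith, by linarith⟩

theorem isCompact_critRegion (hβ : 1 < β) (hA : 0 < A) (hB0 : 0 < B) (hB : B ≤ 1 / 2) :
    IsCompact (critRegion β A B) := by
  obtain ⟨R, -, hR⟩ := exists_critRegion_bound hβ hA hB0 hB
  refine IsCompact.of_isClosed_subset (isCompact_Icc.prod isCompact_Icc) ?_
    (fun p hp => ⟨abs_le.1 (hR p hp).1, abs_le.1 (hR p hp).2⟩)
  rw [critRegion_eq hβ hB0 hB]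
  have hc : ∀ t, Continuous fun p => phaseDeriv β A B p t := fun t => by
    unfold phaseDeriv; fun_prop
  have c1 : IsClosed {p : ℝ × ℝ | |p.2| ≤ 1} :=
    isClosed_le (f := fun p : ℝ × ℝ => |p.2|) (by fun_prop) continuous_const
  exact c1.inter ((isClosed_le (hc _) continuous_const).inter (isClosed_le continuous_const (hc _)))

/-- The reciprocal of the curvature of the phase at its critical point. -/
noncomputable def critRecip (β B : ℝ) (T : ℝ × ℝ → ℝ) (p : ℝ × ℝ) : ℝ :=
  (phaseCurv β B p.2 (T p))⁻¹

theorem IsImplicitSol.mem (hT : IsImplicitSol β A B T) {p : ℝ × ℝ} (hp : p ∈ critRegion β A B) :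
    T p ∈ Set.Icc (1 / 16 : ℝ) (9 / 16) ∧ phaseDeriv β A B p (T p) = 0 := by
  obtain ⟨h, t, ht, h0⟩ := hp
  rw [hT p t (Icc_subset_Ioo_zero_one ht) (by linarith) h0]
  exact ⟨ht, h0⟩

theorem critRecip_mem (hβ : 1 < β) (hB0 : 0 < B) (hB : B ≤ 1 / 2) (hT : IsImplicitSol β A B T)
    {p : ℝ × ℝ} (hp : p ∈ critRegion β A B) :
    (β * (β + 1) * (1 / 16) ^ (-β - 2) + 1)⁻¹ ≤ critRecip β B T p ∧ critRecip β B T p ≤ 1 := by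
  obtain ⟨ht, h0⟩ := hT.mem hp
  have hZ := phaseCurv_gt hβ hB0 hB (Icc_subset_Ioo_zero_one ht) (y := p.2)
  have h1 : T p ^ (-β - 2) ≤ (1 / 16) ^ (-β - 2) :=
    Real.rpow_le_rpow_of_nonpos (by norm_num) ht.1 (by linarith)
  have hp1 := hp.1
  have h2 : -(2 * B * p.2) ≤ 1 := by nlinarith [abs_le.1 hp1]
  have h3 : phaseCurv β B p.2 (T p) ≤ β * (β + 1) * (1 / 16) ^ (-β - 2) + 1 := by
    unfold phaseCurv
    have : β * (β + 1) * T p ^ (-β - 2) ≤ β * (β + 1) * (1 / 16) ^ (-β - 2) := by gcongr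
    linarith
  exact ⟨inv_anti₀ (by linarith) h3, inv_le_one_of_one_le₀ (by linarith)⟩

theorem IsImplicitSol.hasFDerivAt_region (hT : IsImplicitSol β A B T) (hβ : 1 < β) (hA : 0 < A)
    (hB0 : 0 < B) (hB : B ≤ 1 / 2) {p : ℝ × ℝ} (hp : p ∈ critRegion β A B) :
    HasFDerivAt T (critRecip β B T p •
      (A • ContinuousLinearMap.fst ℝ ℝ ℝ + (2 * B * T p) • ContinuousLinearMap.snd ℝ ℝ ℝ)) p := by
  obtain ⟨ht, h0⟩ := hT.mem hp
  exact hT.hasFDerivAt hβ hA hB0 hB (Icc_subset_Ioo_zero_one ht) (by linarith [hp.1]) h0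

/-- The definition of the curvature Z gives β(β+1)T^(-β-2) = Z + 2Bη. Substituting this removes
every power of T with exponent depending on β, so the derivative is rational in T, Z⁻¹ and η. -/
theorem hasFDerivAt_critRecip (hT : IsImplicitSol β A B T) (hβ : 1 < β) (hA : 0 < A)
    (hB0 : 0 < B) (hB : B ≤ 1 / 2) {p : ℝ × ℝ} (hp : p ∈ critRegion β A B) :
    HasFDerivAt (critRecip β B T) (critRecip β B T p ^ 2 •
      (((β + 2) * (1 + 2 * B * p.2 * critRecip β B T p) / T p) •
        (A • ContinuousLinearMap.fst ℝ ℝ ℝ + (2 * B * T p) • ContinuousLinearMap.snd ℝ ℝ ℝ) +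
        (2 * B) • ContinuousLinearMap.snd ℝ ℝ ℝ)) p := by
  obtain ⟨ht, h0⟩ := hT.mem hp
  have ht' := Icc_subset_Ioo_zero_one ht
  have hTd := hT.hasFDerivAt_region hβ hA hB0 hB hp
  have hZ : 0 < phaseCurv β B p.2 (T p) := by
    linarith [phaseCurv_gt hβ hB0 hB ht' (y := p.2), hp.1]
  have e1 := ((Real.hasDerivAt_rpow_const (p := -β - 2)
    (Or.inl ht'.1.ne')).comp_hasFDerivAt p hTd).const_mul (β * (β + 1))
  have e2 : HasFDerivAt (fun q : ℝ × ℝ => 2 * B * q.2)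
      ((2 * B) • ContinuousLinearMap.snd ℝ ℝ ℝ) p := hasFDerivAt_snd.const_mul (2 * B)
  have e3 := (hasDerivAt_inv hZ.ne').comp_hasFDerivAt p (f := fun q => phaseCurv β B q.2 (T q))
    (e1.sub e2)
  refine HasFDerivAt.congr_fderiv e3 ?_
  have hpow : T p ^ (-β - 2 - 1) = T p ^ (-β - 2) / T p := by
    rw [Real.rpow_sub ht'.1, Real.rpow_one]
  have hcurv : β * (β + 1) * T p ^ (-β - 2) = phaseCurv β B p.2 (T p) + 2 * B * p.2 := by
    unfold phaseCurv; ring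
  have ht0 := ht'.1.ne'
  rw [hpow]
  refine ContinuousLinearMap.ext fun q => ?_
  simp only [critRecip]
  set Z := phaseCurv β B p.2 (T p)
  have hZ0 := hZ.ne'
  simp
  field_simp
  linear_combination ((β + 2) * (A * q.1 + 2 * B * T p * q.2)) * hcurv

end Region

/-! ### Double-difference bounds and the critical value. -/

section Bounds

variable {β A B : ℝ} {T : ℝ × ℝ → ℝ}

/-- The derivative of `critRecip` in the second variable. -/
noncomputable def critRecipDeriv (β B : ℝ) (T : ℝ × ℝ → ℝ) (p : ℝ × ℝ) : ℝ :=
  2 * B * critRecip β B T p ^ 2 * ((β + 2) * (1 + 2 * B * p.2 * critRecip β B T p) + 1)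

theorem HasFDerivAt.hasDerivAt_snd {h : ℝ × ℝ → ℝ} {h' : ℝ × ℝ →L[ℝ] ℝ} {p : ℝ × ℝ}
    (H : HasFDerivAt h h' p) : HasDerivAt (fun y => h (p.1, y)) (h' (0, 1)) p.2 :=
  HasFDerivAt.comp_hasDerivAt (f := fun y : ℝ => (p.1, y)) p.2 H
    ((hasDerivAt_const p.2 p.1).prodMk (hasDerivAt_id p.2))

theorem HasFDerivAt.hasDerivAt_fst {h : ℝ × ℝ → ℝ} {h' : ℝ × ℝ →L[ℝ] ℝ} {p : ℝ × ℝ}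
    (H : HasFDerivAt h h' p) : HasDerivAt (fun x => h (x, p.2)) (h' (1, 0)) p.1 :=
  HasFDerivAt.comp_hasDerivAt (f := fun x : ℝ => (x, p.2)) p.1 H
    ((hasDerivAt_id p.1).prodMk (hasDerivAt_const p.1 p.2))

theorem IsImplicitSol.hasDerivAt_snd (hT : IsImplicitSol β A B T) (hβ : 1 < β) (hA : 0 < A)
    (hB0 : 0 < B) (hB : B ≤ 1 / 2) {p : ℝ × ℝ} (hp : p ∈ critRegion β A B) :
    HasDerivAt (fun y => T (p.1, y)) (2 * B * T p * critRecip β B T p) p.2 := by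
  refine (hT.hasFDerivAt_region hβ hA hB0 hB hp).hasDerivAt_snd.congr_deriv ?_
  simp; ring

theorem IsImplicitSol.hasDerivAt_fst (hT : IsImplicitSol β A B T) (hβ : 1 < β) (hA : 0 < A)
    (hB0 : 0 < B) (hB : B ≤ 1 / 2) {p : ℝ × ℝ} (hp : p ∈ critRegion β A B) :
    HasDerivAt (fun x => T (x, p.2)) (A * critRecip β B T p) p.1 := by
  refine (hT.hasFDerivAt_region hβ hA hB0 hB hp).hasDerivAt_fst.congr_deriv ?_
  simp; ring

theorem hasDerivAt_critRecip_snd (hT : IsImplicitSol β A B T) (hβ : 1 < β) (hA : 0 < A)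
    (hB0 : 0 < B) (hB : B ≤ 1 / 2) {p : ℝ × ℝ} (hp : p ∈ critRegion β A B) :
    HasDerivAt (fun y => critRecip β B T (p.1, y)) (critRecipDeriv β B T p) p.2 := by
  refine (hasFDerivAt_critRecip hT hβ hA hB0 hB hp).hasDerivAt_snd.congr_deriv ?_
  have : T p ≠ 0 := by linarith [(hT.mem hp).1.1] |> fun h : 0 < T p => h.ne'
  simp [critRecipDeriv]
  field_simp

/-- The mixed second difference of the critical point is bounded below. -/
theorem le_abs_doubleDiff_crit (hT : IsImplicitSol β A B T) (hβ : 1 < β) (hA : 0 < A)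
    (hB0 : 0 < B) (hB : B ≤ 1 / 2) :
    ∃ c : ℝ, 0 < c ∧ ∀ ε, |ε| * B ≤ A / 4 → ∀ τ y y' x,
      x ∈ parallelogramSet (critRegion β A B) ε τ y y' →
        c * (|τ| * |y - y'|) ≤ |doubleDiff T ε τ y y' x| := by
  set w := (β * (β + 1) * (1 / 16) ^ (-β - 2) + 1)⁻¹ with hw
  have hw0 : 0 < w := by positivity
  refine ⟨2 * B * w ^ 2 * (7 / 16 * A), by positivity, ?_⟩
  intro ε hε τ y y' x hx
  set W := critRecip β B T with hW
  -- Since ∂_ξ T = A W and ∂_η T = 2B T W, the derivative of T along (1, -ε) is W(A - 2εBT).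
  obtain ⟨p, hp, he⟩ := exists_doubleDiff_eq (convex_critRegion hβ hB0 hB)
    (fun p hp => hT.hasFDerivAt_region hβ hA hB0 hB hp)
    (hv := fun p => W p * (A - 2 * ε * B * T p))
    (hvy := fun p => critRecipDeriv β B T p * (A - 2 * ε * B * T p) +
      W p * (-(2 * ε * B * (2 * B * T p * W p))))
    (fun p hp => by simp [hW]; ring)
    (fun p hp => (hasDerivAt_critRecip_snd hT hβ hA hB0 hB hp).mul
      (((hT.hasDerivAt_snd hβ hA hB0 hB hp).const_mul (2 * ε * B)).const_sub A))
    hx.1.1 hx.1.2 hx.2.1 hx.2.2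
  obtain ⟨W1, W2⟩ := critRecip_mem hβ hB0 hB hT hp
  obtain ⟨⟨T1, T2⟩, -⟩ := hT.mem hp
  rw [← hW] at W1 W2
  have hWp : 0 < W p := lt_of_lt_of_le hw0 W1
  set E := (β + 2) * (1 + 2 * B * p.2 * W p) + 1 with hE
  set q := 2 * ε * B * T p with hq
  -- 9/32 = 2 · (1/4) · (9/16), from |ε|B ≤ A/4 and T ≤ 9/16.
  have hq1 : |q| ≤ 9 / 32 * A := by
    have : |q| = 2 * (|ε| * B) * T p := by
      rw [hq, abs_mul, abs_mul, abs_mul, abs_of_pos hB0, abs_of_pos (by linarith : 0 < T p),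
        abs_of_pos (by norm_num : (0 : ℝ) < 2)]
      ring
    rw [this]
    have : 0 ≤ |ε| * B := by positivity
    nlinarith
  have hE1 : 1 ≤ E := by
    have h1 : |2 * B * p.2 * W p| ≤ 1 := by
      rw [abs_mul, abs_mul, abs_of_pos hWp, abs_of_pos (by linarith : 0 < 2 * B)]
      have h2 : 2 * B * |p.2| ≤ 1 := by nlinarith [hp.1, abs_nonneg p.2]
      have h3 : 0 ≤ 2 * B * |p.2| := by positivity
      nlinarith
    have h4 : 0 ≤ 1 + 2 * B * p.2 * W p := by linarith [(abs_le.1 h1).1]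
    have : 0 ≤ (β + 2) * (1 + 2 * B * p.2 * W p) := mul_nonneg (by linarith) h4
    linarith
  have hval : critRecipDeriv β B T p * (A - q) + W p * (-(2 * ε * B * (2 * B * T p * W p))) =
      2 * B * W p ^ 2 * (E * (A - q) - q) := by
    rw [critRecipDeriv, ← hW, ← hE, hq]; ring
  -- As E ≥ 1 and A - q > 0, the left side of the difference dominates A - q, and A - 2q ≥ A -
  -- (9/16)A.
  have hlow : 7 / 16 * A ≤ E * (A - q) - q := by
    have := abs_le.1 hq1
    nlinarith
  rw [he]
  simp only [hval]
  rw [abs_mul, abs_mul, abs_sub_comm y' y,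
    abs_of_pos (mul_pos (by positivity) (by nlinarith) : 0 < 2 * B * W p ^ 2 * (E * (A - q) - q)),
    mul_comm (|τ| * |y - y'|)]
  refine mul_le_mul_of_nonneg_right ?_ (by positivity)
  gcongr

/-- The mixed second difference of `critRecip` is bounded above. -/
theorem abs_doubleDiff_critRecip_le (hT : IsImplicitSol β A B T) (hβ : 1 < β) (hA : 0 < A)
    (hB0 : 0 < B) (hB : B ≤ 1 / 2) {E : ℝ} :
    ∃ M : ℝ, 0 ≤ M ∧ ∀ ε, |ε| ≤ E → ∀ τ y y' x,
      x ∈ parallelogramSet (critRegion β A B) ε τ y y' →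
        |doubleDiff (critRecip β B T) ε τ y y' x| ≤ M * (|τ| * |y - y'|) := by
  set W := critRecip β B T with hW
  set V := critRecipDeriv β B T with hV
  set K := critRegion β A B with hK
  -- the derivative of `∂W/∂ξ - ε ∂W/∂η` in `η`, as `g₁ - ε g₂`
  set D : ℝ × ℝ → ℝ := fun p => 2 * B * W p + 2 * B * p.2 * V p with hD
  set g₁ : ℝ × ℝ → ℝ := fun p => A * (β + 2) *
    (((2 * W p * V p * (1 + 2 * B * p.2 * W p) + W p ^ 2 * D p) * T p -
      W p ^ 2 * (1 + 2 * B * p.2 * W p) * (2 * B * T p * W p)) / T p ^ 2) with hg₁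
  set g₂ : ℝ × ℝ → ℝ := fun p => 2 * B * (2 * W p * V p) *
    ((β + 2) * (1 + 2 * B * p.2 * W p) + 1) + 2 * B * W p ^ 2 * ((β + 2) * D p) with hg₂
  have hTc : ContinuousOn T K := fun p hp =>
    (hT.hasFDerivAt_region hβ hA hB0 hB hp).continuousAt.continuousWithinAt
  have hWc : ContinuousOn W K := fun p hp =>
    (hasFDerivAt_critRecip hT hβ hA hB0 hB hp).continuousAt.continuousWithinAt
  have hT0 : ∀ p ∈ K, T p ≠ 0 := fun p hp => by
    linarith [(hT.mem hp).1.1] |> fun h : 0 < T p => h.ne'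
  have hVc : ContinuousOn V K := by
    have : ContinuousOn (fun p => 2 * B * W p ^ 2 *
      ((β + 2) * (1 + 2 * B * p.2 * W p) + 1)) K := by fun_prop
    exact this
  have hg₁c : ContinuousOn g₁ K := by
    refine continuousOn_const.mul (ContinuousOn.div (by fun_prop) (by fun_prop) ?_)
    exact fun p hp => pow_ne_zero 2 (hT0 p hp)
  have hg₂c : ContinuousOn g₂ K := by fun_prop
  have hKc : IsCompact K := isCompact_critRegion hβ hA hB0 hB
  -- `g₁` and `g₂` do not involve ε, so compactness gives a bound uniform over |ε| ≤ E, hence later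
  -- uniform in j.
  obtain ⟨M₁, hM₁⟩ := hKc.exists_bound_of_continuousOn hg₁c
  obtain ⟨M₂, hM₂⟩ := hKc.exists_bound_of_continuousOn hg₂c
  refine ⟨|M₁| + |E| * |M₂|, by positivity, ?_⟩
  intro ε hε τ y y' x hx
  have hdy : ∀ p ∈ K, HasDerivAt (fun y => (1 + 2 * B * y * W (p.1, y))) (D p) p.2 := by
    intro p hp
    have := ((((hasDerivAt_id p.2).const_mul (2 * B)).mul
      (hasDerivAt_critRecip_snd hT hβ hA hB0 hB hp)).const_add 1)
    refine this.congr_deriv ?_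
    simp only [hD, id, mul_one]
    rfl
  obtain ⟨p, hp, he⟩ := exists_doubleDiff_eq (convex_critRegion hβ hB0 hB) (ε := ε)
    (fun p hp => hasFDerivAt_critRecip hT hβ hA hB0 hB hp)
    (hv := fun p => A * (β + 2) * (W p ^ 2 * (1 + 2 * B * p.2 * W p) / T p) -
      ε * (2 * B * W p ^ 2 * ((β + 2) * (1 + 2 * B * p.2 * W p) + 1)))
    (hvy := fun p => g₁ p - ε * g₂ p)
    (fun p hp => by
      have := hT0 p hp
      simp [hW]
      field_simp
      ring)
    (fun p hp => by
      have w1 := hasDerivAt_critRecip_snd hT hβ hA hB0 hB hp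
      have t1 := hT.hasDerivAt_snd hβ hA hB0 hB hp
      have w2 := w1.pow 2
      have a1 := ((w2.mul (hdy p hp)).div t1 (hT0 p hp)).const_mul (A * (β + 2))
      have a2 := ((w2.const_mul (2 * B)).mul (((hdy p hp).const_mul (β + 2)).add_const 1)).const_mul ε
      refine (a1.sub a2).congr_deriv ?_
      simp [hg₁, hg₂, hV, hW])
    hx.1.1 hx.1.2 hx.2.1 hx.2.2
  rw [he, abs_mul, abs_mul, abs_sub_comm y' y, mul_comm]
  refine mul_le_mul_of_nonneg_right ?_ (by positivity)
  have h1 : |g₁ p| ≤ |M₁| := (hM₁ p hp).trans (le_abs_self _)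
  have h2 : |g₂ p| ≤ |M₂| := (hM₂ p hp).trans (le_abs_self _)
  calc |g₁ p - ε * g₂ p| ≤ |g₁ p| + |ε * g₂ p| := abs_sub _ _
    _ ≤ |M₁| + |E| * |M₂| := by
        rw [abs_mul ε]
        exact add_le_add h1 (mul_le_mul (hε.trans (le_abs_self _)) h2 (abs_nonneg _) (abs_nonneg _))

/-- The critical value of the phase. -/
noncomputable def critValue (β A B : ℝ) (T : ℝ × ℝ → ℝ) (p : ℝ × ℝ) : ℝ :=
  A * p.1 * T p + B * p.2 * T p ^ 2 - T p ^ (-β)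

/-- Envelope principle: the contribution of the moving critical point is multiplied by the
derivative of the phase there, which is zero. -/
theorem hasDerivAt_critValue (hT : IsImplicitSol β A B T) (hβ : 1 < β) (hA : 0 < A)
    (hB0 : 0 < B) (hB : B ≤ 1 / 2) {p : ℝ × ℝ} (hp : p ∈ critRegion β A B) :
    HasDerivAt (fun x => critValue β A B T (x, p.2)) (A * T p) p.1 := by
  obtain ⟨ht, h0⟩ := hT.mem hp
  have ht' := Icc_subset_Ioo_zero_one ht
  have t1 := hT.hasDerivAt_fst hβ hA hB0 hB hp
  have e1 := (((hasDerivAt_id p.1).const_mul A).mul t1).add ((t1.pow 2).const_mul (B * p.2))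
  have e2 := (Real.hasDerivAt_rpow_const (p := -β) (Or.inl ht'.1.ne')).comp p.1 t1
  refine (e1.sub e2).congr_deriv ?_
  unfold phaseDeriv at h0
  simp
  linear_combination (A * critRecip β B T p) * h0

theorem continuousOn_critValue (hT : IsImplicitSol β A B T) (hβ : 1 < β) (hA : 0 < A)
    (hB0 : 0 < B) (hB : B ≤ 1 / 2) : ContinuousOn (critValue β A B T) (critRegion β A B) := by
  have hTc : ContinuousOn T (critRegion β A B) := fun p hp =>
    (hT.hasFDerivAt_region hβ hA hB0 hB hp).continuousAt.continuousWithinAt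
  unfold critValue
  refine ContinuousOn.sub (by fun_prop) (hTc.rpow_const fun p hp => Or.inl ?_)
  exact (Icc_subset_Ioo_zero_one (hT.mem hp).1).1.ne'

end Bounds

/-! ### Lp norms and almost-everywhere representatives. -/

section Lp

theorem toReal_eLpNorm_pow_eq {f : ℝ → ℂ} {n : ℕ} (hn : n ≠ 0) (hf : MemLp f n volume) :
    (eLpNorm f n volume).toReal ^ n = ∫ x, ‖f x‖ ^ n := by
  rw [hf.eLpNorm_eq_integral_rpow_norm (by exact_mod_cast hn) (by simp)]
  simp only [ENNReal.toReal_natCast, Real.rpow_natCast]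
  have h0 : 0 ≤ ∫ x, ‖f x‖ ^ n := integral_nonneg fun x => by positivity
  rw [ENNReal.toReal_ofReal (by positivity), Real.rpow_inv_natCast_pow h0 hn]

theorem integrable_norm_pow_of_memLp {f : ℝ → ℂ} {n : ℕ} (hn : n ≠ 0) (hf : MemLp f n volume) :
    Integrable fun x => ‖f x‖ ^ n := by
  have := hf.integrable_norm_rpow (by exact_mod_cast hn) (by simp)
  simpa using this

theorem memLp_mul_bounded {f g : ℝ → ℂ} {p : ENNReal} {c : ℝ} (hf : MemLp f p volume)
    (hg : Continuous g) (hc : ∀ x, ‖g x‖ ≤ c) :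
    MemLp (fun x => f x * g x) p volume ∧
      (eLpNorm (fun x => f x * g x) p volume).toReal ≤ c * (eLpNorm f p volume).toReal := by
  have hc0 : 0 ≤ c := (norm_nonneg _).trans (hc 0)
  have hle : ∀ᵐ x : ℝ, ‖f x * g x‖ ≤ c * ‖f x‖ := Filter.Eventually.of_forall fun x => by
    rw [norm_mul, mul_comm]
    gcongr
    exact hc x
  refine ⟨hf.of_le_mul (hf.1.mul hg.aestronglyMeasurable) hle, ?_⟩
  have h := eLpNorm_le_mul_eLpNorm_of_ae_le_mul hle p
  have h2 := ENNReal.toReal_mono (ENNReal.mul_ne_top (by simp) hf.eLpNorm_ne_top) h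
  rwa [ENNReal.toReal_mul, ENNReal.toReal_ofReal hc0] at h2

/-- For f₃, null sets pull back under (ξ, η) ↦ εξ + η because it is a measure-preserving shear
followed by a projection. -/
theorem trilinear_ae_congr {f₁ f₂ f₃ g₁ g₂ g₃ : ℝ → ℂ} (h₁ : f₁ =ᵐ[volume] g₁)
    (h₂ : f₂ =ᵐ[volume] g₂) (h₃ : f₃ =ᵐ[volume] g₃) (e : ℝ → ℝ → ℂ) (ε : ℝ) :
    (fun p : ℝ × ℝ => f₁ p.1 * f₂ p.2 * f₃ (ε * p.1 + p.2) * e p.1 p.2) =ᵐ[volume]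
      fun p : ℝ × ℝ => g₁ p.1 * g₂ p.2 * g₃ (ε * p.1 + p.2) * e p.1 p.2 := by
  have q1 : Measure.QuasiMeasurePreserving (Prod.fst : ℝ × ℝ → ℝ) volume volume :=
    Measure.quasiMeasurePreserving_fst
  have q2 : Measure.QuasiMeasurePreserving (Prod.snd : ℝ × ℝ → ℝ) volume volume :=
    Measure.quasiMeasurePreserving_snd
  have q3 := q2.comp (measurePreserving_shear ε).quasiMeasurePreserving
  filter_upwards [q1.ae h₁, q2.ae h₂, q3.ae h₃] with p a1 a2 a3
  simp only [Function.comp] at a3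
  rw [a1, a2, add_comm, a3]

end Lp

/-! ### The decay estimate on the positive interval. -/

section Core

/-- The exponent θ = (4β+1)/(5β) is the solution of βθ - 1 = 4(β-1)/5: the gain λ^(-θ) against the
loss 2^j. -/
theorem rpow_decay_exponent {β : ℝ} (hβ : 1 < β) (j : ℕ) :
    ((2 : ℝ) ^ (β * j)) ^ (-((4 * β + 1) / (5 * β))) * (2 : ℝ) ^ (j : ℤ) =
      ((2 : ℝ) ^ (-((β - 1) / 5) * (j : ℝ))) ^ 4 := by
  rw [← Real.rpow_mul (by norm_num), zpow_natCast, ← Real.rpow_natCast, ← Real.rpow_natCast,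
    ← Real.rpow_mul (by norm_num), ← Real.rpow_add (by norm_num)]
  congr 1
  field_simp
  push_cast
  ring

theorem le_of_pow_four_le {X C r a b c : ℝ} (hC : 0 ≤ C) (hr : 0 ≤ r) (ha : 0 ≤ a) (hb : 0 ≤ b)
    (hc : 0 ≤ c) (h : X ^ 4 ≤ (C * r ^ 4) * a ^ 4 * (b ^ 2) ^ 2 * (c ^ 2) ^ 2) :
    X ≤ (C + 1) * r * a * b * c := by
  refine le_of_pow_le_pow_left₀ (n := 4) (by norm_num) (by positivity) (h.trans ?_)
  have hpow : C ≤ (C + 1) ^ 4 := by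
    have : C + 1 ≤ (C + 1) ^ 4 := le_self_pow₀ (by linarith) (by norm_num)
    linarith
  calc _ ≤ ((C + 1) ^ 4 * r ^ 4) * a ^ 4 * (b ^ 2) ^ 2 * (c ^ 2) ^ 2 := by gcongr
    _ = _ := by ring

/-- The estimate for a kernel living on the region of the critical points in `[1/16, 9/16]`. -/
theorem exists_trilinear_decay {β A B : ℝ} {T : ℝ × ℝ → ℝ} (hT : IsImplicitSol β A B T)
    (hβ : 1 < β) (hA : 0 < A) (hB0 : 0 < B) (hB : B ≤ 1 / 2) {E : ℝ} (hE : 0 < E)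
    (hEB : E * B = A) :
    ∃ C : ℝ, 0 < C ∧ ∀ (j : ℕ) (ε : ℝ), |ε| = E * ((2 : ℝ) ^ (j : ℤ))⁻¹ → ∀ f₁ f₂ f₃ : ℝ → ℂ,
      MemLp f₁ 4 volume → MemLp f₂ 2 volume → MemLp f₃ 2 volume →
      Integrable (fun p : ℝ × ℝ => f₁ p.1 * f₂ p.2 * f₃ (ε * p.1 + p.2) *
        oscKernel (critRegion β A B) (critValue β A B T) ((2 : ℝ) ^ (β * j)) p.1 p.2) volume ∧
      ‖∫ p : ℝ × ℝ, f₁ p.1 * f₂ p.2 * f₃ (ε * p.1 + p.2) *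
        oscKernel (critRegion β A B) (critValue β A B T) ((2 : ℝ) ^ (β * j)) p.1 p.2‖ ≤
        C * (2 : ℝ) ^ (-((β - 1) / 5) * (j : ℝ)) * (eLpNorm f₁ 4 volume).toReal *
          (eLpNorm f₂ 2 volume).toReal * (eLpNorm f₃ 2 volume).toReal := by
  set K := critRegion β A B with hK
  have hKc : IsCompact K := isCompact_critRegion hβ hA hB0 hB
  have hKx : Convex ℝ K := convex_critRegion hβ hB0 hB
  obtain ⟨R, hR1, hR⟩ := exists_critRegion_bound hβ hA hB0 hB
  have hR0 : 0 ≤ R := by linarith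
  obtain ⟨c, hc, hlow⟩ := le_abs_doubleDiff_crit hT hβ hA hB0 hB
  obtain ⟨M, hM, hup⟩ := abs_doubleDiff_critRecip_le hT hβ hA hB0 hB (E := E)
  set θ := (4 * β + 1) / (5 * β) with hθ
  have hθ0 : 0 ≤ θ := by positivity
  have hθ1 : θ < 1 := by rw [hθ, div_lt_one (by positivity)]; linarith
  set D := 2 * R + (2 / (A * c) + 2 * R * (M / c ^ 2)) with hD
  have hD0 : 0 ≤ D := by positivity
  set κ := ∫ x, powWeight (2 * R) θ x with hκ
  set C₁ := D * κ ^ 2 * E⁻¹ with hC₁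
  -- The power of 2 compensates the decay factor r⁴ at j = 1, the last case left to the trivial
  -- bound.
  set C₂ := (2 * R) ^ 3 * (2 : ℝ) ^ (4 * ((β - 1) / 5)) with hC₂
  have hC₁0 : 0 ≤ C₁ := by positivity
  have hC₂0 : 0 ≤ C₂ := by positivity
  have hWc : ContinuousOn (critRecip β B T) K := fun p hp =>
    (hasFDerivAt_critRecip hT hβ hA hB0 hB hp).continuousAt.continuousWithinAt
  refine ⟨C₁ + C₂ + 1, by positivity, ?_⟩
  intro j ε hε f₁ f₂ f₃ h₁ h₂ h₃
  set lam : ℝ := (2 : ℝ) ^ (β * j) with hlam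
  have hlam0 : 0 < lam := by positivity
  set e := oscKernel K (critValue β A B T) lam with he
  have hem : Measurable (Function.uncurry e) :=
    measurable_oscKernel hKc.measurableSet (continuousOn_critValue hT hβ hA hB0 hB) lam
  have he1 : ∀ x y, ‖e x y‖ ≤ 1 := norm_oscKernel_le _ _ _
  have hsupp : ∀ x y, e x y ≠ 0 → |x| ≤ R ∧ |y| ≤ R := fun x y h =>
    hR _ (mem_of_oscKernel_ne_zero h)
  -- measurable representatives
  set g₁ := h₁.1.mk f₁
  set g₂ := h₂.1.mk f₂
  set g₃ := h₃.1.mk f₃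
  have a₁ : f₁ =ᵐ[volume] g₁ := h₁.1.ae_eq_mk
  have a₂ : f₂ =ᵐ[volume] g₂ := h₂.1.ae_eq_mk
  have a₃ : f₃ =ᵐ[volume] g₃ := h₃.1.ae_eq_mk
  have m₁ : Measurable g₁ := h₁.1.stronglyMeasurable_mk.measurable
  have m₂ : Measurable g₂ := h₂.1.stronglyMeasurable_mk.measurable
  have m₃ : Measurable g₃ := h₃.1.stronglyMeasurable_mk.measurable
  have l₁ : MemLp g₁ (4 : ℕ) volume := (memLp_congr_ae a₁).1 h₁
  have l₂ : MemLp g₂ (2 : ℕ) volume := (memLp_congr_ae a₂).1 h₂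
  have l₃ : MemLp g₃ (2 : ℕ) volume := (memLp_congr_ae a₃).1 h₃
  have i₁ := integrable_norm_pow_of_memLp (by norm_num) l₁
  have i₂ := integrable_norm_pow_of_memLp (by norm_num) l₂
  have i₃ := integrable_norm_pow_of_memLp (by norm_num) l₃
  have hae := trilinear_ae_congr a₁ a₂ a₃ e ε
  refine ⟨(integrable_congr hae).2 (integrable_trilinear m₁ m₂ m₃ hem i₁ i₂ i₃ he1 hsupp ε), ?_⟩
  rw [integral_congr_ae hae, eLpNorm_congr_ae a₁, eLpNorm_congr_ae a₂, eLpNorm_congr_ae a₃]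
  set r : ℝ := (2 : ℝ) ^ (-((β - 1) / 5) * (j : ℝ)) with hr
  have hr0 : 0 < r := by positivity
  have n₁ := toReal_eLpNorm_pow_eq (by norm_num) l₁
  have n₂ := toReal_eLpNorm_pow_eq (by norm_num) l₂
  have n₃ := toReal_eLpNorm_pow_eq (by norm_num) l₃
  simp only [Nat.cast_ofNat] at n₁ n₂ n₃
  set N₁ := (eLpNorm g₁ 4 volume).toReal
  set N₂ := (eLpNorm g₂ 2 volume).toReal
  set N₃ := (eLpNorm g₃ 2 volume).toReal
  have hN₁ : 0 ≤ N₁ := ENNReal.toReal_nonneg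
  have hN₂ : 0 ≤ N₂ := ENNReal.toReal_nonneg
  have hN₃ : 0 ≤ N₃ := ENNReal.toReal_nonneg
  have hX : ‖∫ p : ℝ × ℝ, g₁ p.1 * g₂ p.2 * g₃ (ε * p.1 + p.2) * e p.1 p.2‖ ^ 4 ≤
      ((C₁ + C₂) * r ^ 4) * N₁ ^ 4 * (N₂ ^ 2) ^ 2 * (N₃ ^ 2) ^ 2 := by
    rw [n₁, n₂, n₃]
    -- Here |ε|B = A·2^(-j), so j ≥ 2 is exactly the condition |ε|B ≤ A/4 needed for the lower bound
    -- on the double difference.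
    rcases le_or_gt 2 j with hj | hj
    · have hε0 : ε ≠ 0 := by
        rw [← abs_pos, hε]; positivity
      have h4 : (4 : ℝ) ≤ (2 : ℝ) ^ (j : ℤ) := by
        rw [zpow_natCast]
        calc (4 : ℝ) = 2 ^ 2 := by norm_num
          _ ≤ 2 ^ j := pow_le_pow_right₀ (by norm_num) hj
      have hinv : ((2 : ℝ) ^ (j : ℤ))⁻¹ ≤ 1 / 4 := by
        rw [one_div]; exact inv_anti₀ (by norm_num) h4
      have hεB : |ε| * B ≤ A / 4 := by
        rw [hε, ← hEB]
        have : 0 < E * B := by positivity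
        nlinarith
      have hεE : |ε| ≤ E := by
        rw [hε]; nlinarith
      have hcor : ∀ τ, τ ≠ 0 → ∀ y y', y ≠ y' →
          ‖∫ x, (e x y * conj (e (x + τ) (y - ε * τ))) *
            conj (e x y' * conj (e (x + τ) (y' - ε * τ)))‖ ≤
            (D * lam ^ (-θ)) * |τ| ^ (-θ) * |y - y'| ^ (-θ) := by
        intro τ hτ y y' hy
        exact norm_correlation_oscKernel_le hKc hKx hA hc hM hR0 hlam0 hθ0 hθ1.le
          (fun p hp => (hR p hp).1)
          (fun p hp => hasDerivAt_critValue hT hβ hA hB0 hB hp)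
          (fun p hp => hT.hasDerivAt_fst hβ hA hB0 hB hp) hWc
          (hlow ε hεB) (hup ε hεE) hτ hy
      refine (norm_trilinear_pow_four_le m₁ m₂ m₃ hem i₁ i₂ i₃ hR0 hθ1 (by positivity) hε0
        he1 hsupp hcor).trans ?_
      have hconst : D * lam ^ (-θ) * κ ^ 2 * |ε|⁻¹ = C₁ * r ^ 4 := by
        rw [hr, ← rpow_decay_exponent hβ j, hε, mul_inv, inv_inv, hC₁]
        ring
      rw [hconst]
      have : 0 ≤ C₂ * r ^ 4 := by positivity
      gcongr
      linarith
    · refine (norm_trilinear_pow_four_le_trivial m₁ m₂ m₃ i₁ i₂ i₃ hR0 he1 hsupp ε).trans ?_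
      have hr4 : 1 ≤ (2 : ℝ) ^ (4 * ((β - 1) / 5)) * r ^ 4 := by
        rw [hr, ← Real.rpow_natCast, ← Real.rpow_mul (by norm_num), ← Real.rpow_add (by norm_num)]
        refine Real.one_le_rpow (by norm_num) ?_
        have : (j : ℝ) ≤ 1 := by exact_mod_cast Nat.lt_succ_iff.1 hj
        push_cast
        nlinarith
      have : (2 * R) ^ 3 ≤ (C₁ + C₂) * r ^ 4 := by
        have h5 : 0 ≤ C₁ * r ^ 4 := by positivity
        have h6 : (2 * R) ^ 3 * 1 ≤ (2 * R) ^ 3 * ((2 : ℝ) ^ (4 * ((β - 1) / 5)) * r ^ 4) := by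
          gcongr
        rw [hC₂]
        linarith
      gcongr
  exact le_of_pow_four_le (by positivity) hr0.le hN₁ hN₂ hN₃ hX

end Core

/-! ### Back to the original phase, and the reflection in ξ. -/

section Transfer

variable {β : ℝ} {m : ℤ}

theorem two_zpow_bBeta_le (hβ : 1 < β) : (2 : ℝ) ^ (-bBeta β + 2) ≤ 1 / 2 := by
  have hb : (100 : ℤ) ≤ bBeta β := by
    refine Int.le_floor.2 ?_
    have := one_le_pow₀ hβ.le (n := 100)
    push_cast
    linarith
  calc (2 : ℝ) ^ (-bBeta β + 2) ≤ (2 : ℝ) ^ (-1 : ℤ) :=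
        zpow_le_zpow_right₀ (by norm_num) (by omega)
    _ = 1 / 2 := by norm_num

/-- The critical point in `(0, 1)` as a function of the frequencies. -/
noncomputable def critFun (β : ℝ) (m : ℤ) (p : ℝ × ℝ) : ℝ := critPoint β m (Set.Ioo 0 1) p.1 p.2

theorem critPoint_spec {J : Set ℝ} {ξ η : ℝ} (h : ∃ t, IsCritPoint β m J ξ η t) :
    IsCritPoint β m J ξ η (critPoint β m J ξ η) := by
  rw [critPoint, dif_pos h]
  exact h.choose_spec

theorem deriv_phase4_eq (β : ℝ) (m : ℤ) (p : ℝ × ℝ) {t : ℝ} (ht : 0 < t) :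
    deriv (phase4 β m p.1 p.2) t =
      phaseDeriv β ((2 : ℝ) ^ (m + 1)) ((2 : ℝ) ^ (-bBeta β + 2)) p t :=
  deriv_phase4_of_pos β m p.1 p.2 t ht

/-- Searching for the critical point in (0,1) instead of [1/16, 9/16] makes it defined and unique on
a neighbourhood of the critical region, so that it can be differentiated up to the boundary. -/
theorem isImplicitSol_critFun (hβ : 1 < β) :
    IsImplicitSol β ((2 : ℝ) ^ (m + 1)) ((2 : ℝ) ^ (-bBeta β + 2)) (critFun β m) := by
  intro p t ht hp h
  have hs : IsCritPoint β m (Set.Ioo 0 1) p.1 p.2 (critFun β m p) :=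
    critPoint_spec ⟨t, ht, by rw [deriv_phase4_eq β m p ht.1, h]⟩
  have h' := hs.2
  rw [deriv_phase4_eq β m p hs.1.1] at h'
  exact (strictAntiOn_phaseDeriv hβ (by positivity) (two_zpow_bBeta_le hβ) hp).injOn hs.1 ht
    (h'.trans h.symm)

theorem isCritPoint_pos_iff {p : ℝ × ℝ} {t : ℝ} :
    IsCritPoint β m (Set.Icc (1 / 16) (9 / 16)) p.1 p.2 t ↔
      t ∈ Set.Icc (1 / 16 : ℝ) (9 / 16) ∧
        phaseDeriv β ((2 : ℝ) ^ (m + 1)) ((2 : ℝ) ^ (-bBeta β + 2)) p t = 0 := by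
  refine and_congr_right fun ht => ?_
  rw [deriv_phase4_eq β m p (Icc_subset_Ioo_zero_one ht).1]

theorem isCritPoint_neg_iff {ξ η t : ℝ} :
    IsCritPoint β m (Set.Icc (-9 / 16) (-1 / 16)) ξ η t ↔
      IsCritPoint β m (Set.Icc (1 / 16) (9 / 16)) (-ξ) η (-t) := by
  refine ⟨fun h => h.neg, ?_⟩
  rintro ⟨⟨h1, h2⟩, h3⟩
  refine ⟨⟨by linarith, by linarith⟩, ?_⟩
  have e : phase4 β m (-ξ) η = fun s => phase4 β m ξ η (-s) := by
    funext s
    rw [phase4_neg]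
  rw [e, deriv_comp_neg, neg_neg] at h3
  linarith

theorem phase4_eq_critValue (hβ : 1 < β) {p : ℝ × ℝ} (hp : |p.2| ≤ 1) {t : ℝ}
    (ht : IsCritPoint β m (Set.Icc (1 / 16) (9 / 16)) p.1 p.2 t) :
    phase4 β m p.1 p.2 t =
      critValue β ((2 : ℝ) ^ (m + 1)) ((2 : ℝ) ^ (-bBeta β + 2)) (critFun β m) p := by
  obtain ⟨h1, h2⟩ := isCritPoint_pos_iff.1 ht
  have h3 := Icc_subset_Ioo_zero_one h1
  rw [critValue, isImplicitSol_critFun hβ p t h3 (by linarith) h2, phase4, abs_of_pos h3.1]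

theorem mem_critSet_pos_iff {p : ℝ × ℝ} (hp : |p.2| ≤ 1) :
    p ∈ critSet β m (Set.Icc (1 / 16) (9 / 16)) ↔
      p ∈ critRegion β ((2 : ℝ) ^ (m + 1)) ((2 : ℝ) ^ (-bBeta β + 2)) :=
  ⟨fun ⟨t, ht⟩ => ⟨hp, t, isCritPoint_pos_iff.1 ht⟩,
    fun ⟨_, t, ht⟩ => ⟨t, isCritPoint_pos_iff.2 ht⟩⟩

theorem mem_critSet_neg_iff {p : ℝ × ℝ} (hp : |p.2| ≤ 1) :
    p ∈ critSet β m (Set.Icc (-9 / 16) (-1 / 16)) ↔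
      (-p.1, p.2) ∈ critRegion β ((2 : ℝ) ^ (m + 1)) ((2 : ℝ) ^ (-bBeta β + 2)) := by
  rw [← mem_critSet_pos_iff (p := (-p.1, p.2)) hp]
  constructor
  · rintro ⟨t, ht⟩
    exact ⟨-t, isCritPoint_neg_iff.1 ht⟩
  · rintro ⟨t, ht⟩
    exact ⟨-t, isCritPoint_neg_iff.2 (by rwa [neg_neg])⟩

theorem phaseQ_pos_eq (hβ : 1 < β) {p : ℝ × ℝ} (hp : |p.2| ≤ 1)
    (h : p ∈ critSet β m (Set.Icc (1 / 16) (9 / 16))) :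
    phaseQ β m (Set.Icc (1 / 16) (9 / 16)) p.1 p.2 =
      critValue β ((2 : ℝ) ^ (m + 1)) ((2 : ℝ) ^ (-bBeta β + 2)) (critFun β m) p :=
  phase4_eq_critValue hβ hp (critPoint_spec h)

theorem phaseQ_neg_eq (hβ : 1 < β) {p : ℝ × ℝ} (hp : |p.2| ≤ 1)
    (h : p ∈ critSet β m (Set.Icc (-9 / 16) (-1 / 16))) :
    phaseQ β m (Set.Icc (-9 / 16) (-1 / 16)) p.1 p.2 =
      critValue β ((2 : ℝ) ^ (m + 1)) ((2 : ℝ) ^ (-bBeta β + 2)) (critFun β m) (-p.1, p.2) := by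
  have h1 := isCritPoint_neg_iff.1 (critPoint_spec h)
  rw [← phase4_eq_critValue hβ (p := (-p.1, p.2)) hp h1, phaseQ, phase4_neg, neg_neg]

/-- The cutoffs are absorbed into f₁ and f₂. Both sides vanish where Θ(η) = 0, so the
identifications matter only for |η| ≤ 1. The separate point `q` accommodates the reflected interval.
-/
theorem oscIntegrand_eq {Θ : 𝓢(ℝ, ℂ)} (hΘ : Function.support Θ ⊆ Set.Ioo (-1) 1)
    {J : Set ℝ} {K : Set (ℝ × ℝ)} {V : ℝ × ℝ → ℝ} {p q : ℝ × ℝ}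
    (hmem : |p.2| ≤ 1 → (p ∈ critSet β m J ↔ q ∈ K))
    (hV : |p.2| ≤ 1 → p ∈ critSet β m J → phaseQ β m J p.1 p.2 = V q) (j : ℕ)
    (f₁ f₂ f₃ : ℝ → ℂ) :
    oscIntegrand Θ β m j J f₁ f₂ f₃ p =
      (f₁ p.1 * hatPhi Θ p.1) * (f₂ p.2 * Θ p.2) *
        f₃ ((2 : ℝ) ^ (bBeta β + m - 1 - (j : ℤ)) * p.1 + p.2) *
        oscKernel K V ((2 : ℝ) ^ (β * j)) q.1 q.2 := by
  unfold oscIntegrand oscKernel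
  by_cases h0 : Θ p.2 = 0
  · simp [h0]
  have hp : |p.2| ≤ 1 := by
    have := hΘ (Function.mem_support.2 h0)
    exact abs_le.2 ⟨this.1.le, this.2.le⟩
  by_cases h1 : p ∈ critSet β m J
  · rw [Set.indicator_of_mem h1, Set.indicator_of_mem (by simpa using (hmem hp).1 h1), hV hp h1]
    ring
  · rw [Set.indicator_of_notMem h1, Set.indicator_of_notMem (fun h => h1 ((hmem hp).2 h)), mul_zero]

theorem measurePreserving_neg_fst :
    MeasurePreserving (fun p : ℝ × ℝ => (-p.1, p.2)) :=
  MeasurePreserving.prod (f := fun x : ℝ => -x) (g := (id : ℝ → ℝ))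
    (Measure.measurePreserving_neg volume) (MeasurePreserving.id volume)

theorem measurableEmbedding_neg_fst :
    MeasurableEmbedding (fun p : ℝ × ℝ => (-p.1, p.2)) := by
  refine MeasurableEmbedding.of_measurable_inverse (g := fun p : ℝ × ℝ => (-p.1, p.2))
    (by fun_prop) ?_ (by fun_prop) (fun p => by simp)
  convert MeasurableSet.univ
  exact Set.range_eq_univ.2 fun p => ⟨(-p.1, p.2), by simp⟩

/-- The estimate for a fixed `m`. -/
theorem exists_oscForm_bound {Θ : 𝓢(ℝ, ℂ)} (hΘ : Function.support Θ ⊆ Set.Ioo (-1) 1)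
    (hβ : 1 < β) (m : ℤ) :
    ∃ C : ℝ, 0 < C ∧
      ∀ J : Set ℝ, (J = Set.Icc (1 / 16) (9 / 16) ∨ J = Set.Icc (-9 / 16) (-1 / 16)) →
      ∀ j : ℕ, ∀ f₁ f₂ f₃ : ℝ → ℂ,
        MemLp f₁ 4 volume → MemLp f₂ 2 volume → MemLp f₃ 2 volume →
        Integrable (oscIntegrand Θ β m j J f₁ f₂ f₃) volume ∧
        ‖oscForm Θ β m j J f₁ f₂ f₃‖ ≤
          C * (2 : ℝ) ^ (-((β - 1) / 5) * (j : ℝ)) *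
            (eLpNorm f₁ 4 volume).toReal * (eLpNorm f₂ 2 volume).toReal *
            (eLpNorm f₃ 2 volume).toReal := by
  set A := (2 : ℝ) ^ (m + 1) with hA
  set B := (2 : ℝ) ^ (-bBeta β + 2) with hB
  set E := (2 : ℝ) ^ (bBeta β + m - 1) with hE
  have hEB : E * B = A := by
    rw [hE, hB, hA, ← zpow_add₀ (by norm_num)]
    congr 1
    ring
  obtain ⟨C, hC, hmain⟩ := exists_trilinear_decay (isImplicitSol_critFun (m := m) hβ) hβ
    (by positivity) (by positivity) (two_zpow_bBeta_le hβ) (E := E) (by positivity) hEB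
  obtain ⟨c, hc, hΘc⟩ : ∃ c : ℝ, 0 < c ∧ ∀ x, ‖Θ x‖ ≤ c := by
    obtain ⟨c, hc⟩ := Θ.decay 0 0
    exact ⟨c, hc.1, fun x => by simpa using hc.2 x⟩
  have hΦc : ∀ x, ‖hatPhi Θ x‖ ≤ 2 * c := fun x => by
    have := norm_sub_le (Θ (x / 2)) (Θ x)
    have := hΘc (x / 2)
    have := hΘc x
    unfold hatPhi
    linarith
  have hΦcont : Continuous (hatPhi Θ) := by
    have := Θ.continuous
    unfold hatPhi
    fun_prop
  refine ⟨C * (2 * c) * c, by positivity, ?_⟩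
  intro J hJ j f₁ f₂ f₃ h₁ h₂ h₃
  have hEj : (2 : ℝ) ^ (bBeta β + m - 1 - (j : ℤ)) = E * ((2 : ℝ) ^ (j : ℤ))⁻¹ := by
    rw [hE, zpow_sub₀ (by norm_num), div_eq_mul_inv]
  set Ej := (2 : ℝ) ^ (bBeta β + m - 1 - (j : ℤ)) with hEjdef
  have hEj0 : 0 < Ej := by positivity
  obtain ⟨q₁, n₁⟩ := memLp_mul_bounded h₁ hΦcont hΦc
  obtain ⟨q₂, n₂⟩ := memLp_mul_bounded h₂ Θ.continuous hΘc
  have hfin : ∀ {X r N₁ N₂ N₃ M₁ M₂ : ℝ}, 0 ≤ r → 0 ≤ N₃ → 0 ≤ N₁ → 0 ≤ M₂ →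
      X ≤ C * r * M₁ * M₂ * N₃ → M₁ ≤ 2 * c * N₁ → M₂ ≤ c * N₂ →
      X ≤ C * (2 * c) * c * r * N₁ * N₂ * N₃ := by
    intro X r N₁ N₂ N₃ M₁ M₂ hr h3 h1 h4 hX hM₁ hM₂
    calc X ≤ C * r * M₁ * M₂ * N₃ := hX
      _ ≤ C * r * (2 * c * N₁) * (c * N₂) * N₃ := by gcongr
      _ = _ := by ring
  rcases hJ with rfl | rfl
  · have heq : oscIntegrand Θ β m j (Set.Icc (1 / 16) (9 / 16)) f₁ f₂ f₃ = fun p =>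
        (f₁ p.1 * hatPhi Θ p.1) * (f₂ p.2 * Θ p.2) * f₃ (Ej * p.1 + p.2) *
          oscKernel (critRegion β A B) (critValue β A B (critFun β m)) ((2 : ℝ) ^ (β * j))
            p.1 p.2 := by
      funext p
      exact oscIntegrand_eq hΘ (fun hp => mem_critSet_pos_iff hp)
        (fun hp h => phaseQ_pos_eq hβ hp h) j f₁ f₂ f₃
    obtain ⟨r1, r2⟩ := hmain j Ej (by rw [abs_of_pos hEj0, hEj]) _ _ f₃ q₁ q₂ h₃
    rw [oscForm, heq]
    exact ⟨r1, hfin (by positivity) ENNReal.toReal_nonneg ENNReal.toReal_nonneg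
      ENNReal.toReal_nonneg r2 n₁ n₂⟩
  -- The phase is invariant under (ξ, t) ↦ (-ξ, -t). The reflection turns ε into -ε, which is why
  -- the decay estimate constrains only |ε|.
  · set F₁ : ℝ → ℂ := fun x => f₁ (-x) * hatPhi Θ (-x) with hF₁
    have hneg : MeasurePreserving (fun x : ℝ => -x) volume volume :=
      Measure.measurePreserving_neg volume
    have hF₁m : MemLp F₁ 4 volume := q₁.comp_measurePreserving hneg
    have hF₁n : eLpNorm F₁ 4 volume = eLpNorm (fun x => f₁ x * hatPhi Θ x) 4 volume :=
      eLpNorm_comp_measurePreserving (p := 4) (g := fun x => f₁ x * hatPhi Θ x) q₁.1 hneg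
    set Ψ : ℝ × ℝ → ℂ := fun p => F₁ p.1 * (f₂ p.2 * Θ p.2) * f₃ (-Ej * p.1 + p.2) *
          oscKernel (critRegion β A B) (critValue β A B (critFun β m)) ((2 : ℝ) ^ (β * j))
            p.1 p.2 with hΨ
    have heq : oscIntegrand Θ β m j (Set.Icc (-9 / 16) (-1 / 16)) f₁ f₂ f₃ = fun p =>
        Ψ (-p.1, p.2) := by
      funext p
      refine (oscIntegrand_eq hΘ (q := (-p.1, p.2)) (fun hp => mem_critSet_neg_iff hp)
        (fun hp h => phaseQ_neg_eq hβ hp h) j f₁ f₂ f₃).trans ?_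
      simp only [hΨ, hF₁, neg_neg, neg_mul_neg, ← hEjdef, hA, hB]
    obtain ⟨r1, r2⟩ := hmain j (-Ej) (by rw [abs_neg, abs_of_pos hEj0, hEj]) _ _ f₃ hF₁m q₂ h₃
    rw [oscForm, heq]
    refine ⟨(measurePreserving_neg_fst.integrable_comp r1.aestronglyMeasurable).2 r1, ?_⟩
    rw [measurePreserving_neg_fst.integral_comp measurableEmbedding_neg_fst Ψ]
    rw [hF₁n] at r2
    exact hfin (by positivity) ENNReal.toReal_nonneg ENNReal.toReal_nonneg
      ENNReal.toReal_nonneg r2 n₁ n₂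

end Transfer

theorem mainTheorem4
    (Θ : 𝓢(ℝ, ℂ))
    (hΘsupp : Function.support Θ ⊆ Set.Ioo (-1) 1)
    (hΘone : ∀ ξ : ℝ, |ξ| ≤ 1 / 2 → Θ ξ = 1)
    (β : ℝ) (hβ : 1 < β) :
    ∃ C : ℝ, 0 < C ∧
      ∀ J : Set ℝ, (J = Set.Icc (1 / 16) (9 / 16) ∨ J = Set.Icc (-9 / 16) (-1 / 16)) →
      ∀ m : ℤ, -bBeta β < m → m < bBeta β →
      ∀ j : ℕ,
      ∀ f₁ f₂ f₃ : ℝ → ℂ,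
        MemLp f₁ 4 volume → MemLp f₂ 2 volume → MemLp f₃ 2 volume →
        Integrable (oscIntegrand Θ β m j J f₁ f₂ f₃) volume ∧
        ‖oscForm Θ β m j J f₁ f₂ f₃‖ ≤
          C * (2 : ℝ) ^ (-((β - 1) / 5) * (j : ℝ)) *
            (eLpNorm f₁ 4 volume).toReal * (eLpNorm f₂ 2 volume).toReal *
            (eLpNorm f₃ 2 volume).toReal := by
  -- The constant for each m comes partly from compactness and depends on m; only finitely many m
  -- are allowed, in a range determined by β, so a sum removes the dependence.
  choose C hC hbound using fun m : ℤ => exists_oscForm_bound hΘsupp hβ m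
  refine ⟨∑ m ∈ Finset.Ioo (-bBeta β) (bBeta β), C m + 1, ?_, ?_⟩
  · have : 0 ≤ ∑ m ∈ Finset.Ioo (-bBeta β) (bBeta β), C m :=
      Finset.sum_nonneg fun m _ => (hC m).le
    linarith
  · intro J hJ m hm₁ hm₂ j f₁ f₂ f₃ h₁ h₂ h₃
    obtain ⟨hi, hb⟩ := hbound m J hJ j f₁ f₂ f₃ h₁ h₂ h₃
    refine ⟨hi, hb.trans ?_⟩
    have hle : C m ≤ ∑ m ∈ Finset.Ioo (-bBeta β) (bBeta β), C m + 1 := by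
      have := Finset.single_le_sum (f := C) (fun m _ => (hC m).le)
        (Finset.mem_Ioo.2 ⟨hm₁, hm₂⟩)
      linarith
    gcongr
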